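/- A rooted chord diagram $C$ with $|C|=n$ chords is a perfect matching of $2n$ points $p_1,\dots,p_{2n}$ placed counterclockwise on a circle, $p_1$ being the root; each matched pair is a chord, and chords are ordered counterclockwise by their first endpoints. Two chords $a<b$ intersect when the endpoints of $b$ are separated by those of $a$; in that case the directed intersection graph has an edge $a\to b$. $C$ is connected if $n\ge 1$ and its intersection graph is connected; let $\mathcal{RCCD}$ be the set of rooted connected chord diagrams. A chord is terminal if it has no outgoing edge. The intersection order of the chords of $C$ is defined recursively: list the first chord (in the counterclockwise order); delete it; then list the connected components of what remains one after the other, in increasing order of their counterclockwise-first chords, each component being listed by the same procedure. Label the chords $1,\dots,n$ in this order. Let $t_1<\dots<t_{k+1}$ be the labels of the terminal chords, and put $b(C)=t_1$, $\delta_j=t_{j+1}-t_j$ for $1\le j\le k$. Given elements $f_0,f_1,f_2,\dots$ of a commutative $\mathbb{Q}$-algebra $R$ (for instance a field of characteristic $0$), put $$f_C=f_0^{\,n-k-1}f_{\delta_1}f_{\delta_2}\cdots f_{\delta_k},$$ and for $i\ge 1$ $$\gamma_i(x)=\frac{(-1)^i}{i!}\sum_{\substack{C\in\mathcal{RCCD}\\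 b(C)\ge i}}x^{|C|}f_C\,f_{b(C)-i}\in R[[x]],\qquad F(\rho)=\frac{f_0}{\rho}+f_1+f_2\rho+f_3\rho^2+\cdots .$$ **Theorem.** The series $G(x,L)=1-\sum_{n\ge 1}\gamma_n(x)L^n\in R[[x]][[L]]$ is a formal solution of the Dyson–Schwinger equation $$G(x,L)=1-x\,G(x,\partial_{-\rho})^{-1}\,(e^{-L\rho}-1)F(\rho)\Big|_{\rho=0},$$ where $\partial_{-\rho}=-\frac{d}{d\rho}$. Explicitly: $G(x,D)$ has an inverse $\sum_{k\ge0}h_k(x)D^k$ in $R[[x]][[D]]$; $\Phi=(e^{-L\rho}-1)F(\rho)$ is a power series in $\rho$ with coefficients in $R[[L]]$; the series $\sum_{k\ge 0}h_k(x)\,\partial_{-\rho}^k\Phi$ converges coefficientwise, the coefficient of each monomial $x^nL^m\rho^r$ in its partial sums being eventually constant; and the equation holds when $G(x,\partial_{-\rho})^{-1}\Phi$ denotes its sum. -/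

import Mathlib

open scoped Classical PowerSeries LaurentSeries

noncomputable section

/-- A rooted chord diagram with `n` chords. The `2 n` points of the circle are numbered
`0, …, 2 n - 1` counterclockwise starting from the root; `partner p` is the other endpoint of the
chord through `p`. -/
@[ext]
structure RootedChordDiagram (n : ℕ) where
  partner : Fin (2 * n) → Fin (2 * n)
  partner_partner : ∀ p, partner (partner p) = p
  partner_ne : ∀ p, partner p ≠ p

instance RootedChordDiagram.instFintype (n : ℕ) : Fintype (RootedChordDiagram n) :=
  Fintype.ofInjective RootedChordDiagram.partner fun _ _ h => RootedChordDiagram.ext h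

namespace RootedChordDiagram

variable {n : ℕ} (D : RootedChordDiagram n)

/-- The chords, each one represented by the endpoint that is met first when going
counterclockwise from the root. The order inherited from `Fin (2 * n)` is the counterclockwise
order of the chords. -/
abbrev Chord : Type := {p : Fin (2 * n) // p < D.partner p}

/-- There is a directed edge from `a` to `b` in the directed intersection graph: `a` precedes `b`
in the counterclockwise order and the two chords intersect. -/
def Edge (a b : D.Chord) : Prop :=
  a.1 < b.1 ∧ b.1 < D.partner a.1 ∧ D.partner a.1 < D.partner b.1

/-- The underlying undirected intersection graph. -/
def intersectionGraph : SimpleGraph D.Chord where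
  Adj a b := D.Edge a b ∨ D.Edge b a
  symm := ⟨fun _ _ h => h.symm⟩
  loopless := ⟨fun _ h => h.elim (fun e => lt_irrefl _ e.1) (fun e => lt_irrefl _ e.1)⟩

/-- The diagram is connected (in particular it has at least one chord). -/
def IsConnected : Prop := D.intersectionGraph.Connected

/-- A chord is terminal if it has no outgoing edge. -/
def IsTerminal (a : D.Chord) : Prop := ∀ b, ¬ D.Edge a b

/-- The connected component of `v` in the intersection graph restricted to the set `S` of
chords. -/
def component (S : Finset D.Chord) (v : D.Chord) : Finset D.Chord :=
  S.filter fun w => ∃ (hv : v ∈ (S : Set D.Chord)) (hw : w ∈ (S : Set D.Chord)),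
    (D.intersectionGraph.induce (S : Set D.Chord)).Reachable ⟨v, hv⟩ ⟨w, hw⟩

theorem mem_component_self {S : Finset D.Chord} {v : D.Chord} (hv : v ∈ S) :
    v ∈ D.component S v :=
  Finset.mem_filter.2 ⟨hv, hv, hv, SimpleGraph.Reachable.refl _⟩

theorem component_subset (S : Finset D.Chord) (v : D.Chord) : D.component S v ⊆ S :=
  Finset.filter_subset _ _

/-- The list of the chords in `S` in the intersection order. The connected components of `S` are
listed one after the other, by increasing smallest chord (counterclockwise), and each of them is
listed as its smallest chord followed by the remaining chords of that component, to which
the same procedure is applied. -/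
def orderOn (S : Finset D.Chord) : List D.Chord :=
  if h : S.Nonempty then
    S.min' h :: (orderOn ((D.component S (S.min' h)).erase (S.min' h)) ++
      orderOn (S \ D.component S (S.min' h)))
  else []
termination_by S.card
decreasing_by
  · exact Finset.card_lt_card
      (lt_of_lt_of_le (Finset.erase_ssubset (D.mem_component_self (S.min'_mem h)))
        (D.component_subset S _))
  · exact Finset.card_lt_card
      (Finset.sdiff_ssubset (D.component_subset S _)
        ⟨_, D.mem_component_self (S.min'_mem h)⟩)

/-- All the chords, in the intersection order. -/
def intersectionOrder : List D.Chord := D.orderOn Finset.univ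

/-- The label of a chord in the intersection order; labels are `1, …, n`. -/
def label (c : D.Chord) : ℕ := D.intersectionOrder.idxOf c + 1

/-- The increasing list of the labels of the terminal chords. -/
def terminalLabels : List ℕ :=
  (D.intersectionOrder.filter fun c => decide (D.IsTerminal c)).map D.label

/-- `b D`, the smallest label of a terminal chord (with the value `0` for the diagram without
chords, which is not connected). -/
def b : ℕ := D.terminalLabels.headD 0

/-- The sequence `δ` of the gaps between consecutive terminal labels. -/
def gaps : List ℕ := List.zipWith (fun i j => j - i) D.terminalLabels D.terminalLabels.tail

/-- The monomial `f_D = f_0 ^ (n - k - 1) f_{δ_1} ⋯ f_{δ_k}`, where `δ = (δ_1, …, δ_k)`. -/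
def monomial {R : Type*} [CommRing R] (f : ℕ → R) : R :=
  f 0 ^ (n - D.gaps.length - 1) * (D.gaps.map f).prod

end RootedChordDiagram

namespace DysonSchwinger

variable {R : Type*} [CommRing R] [Algebra ℚ R]

/-- `γ_i(x) = ((-1)^i / i!) ∑_{C, b(C) ≥ i} x^{|C|} f_C f_{b(C) - i}`, the sum being over the
rooted connected chord diagrams. -/
def gamma (f : ℕ → R) (i : ℕ) : R⟦X⟧ :=
  PowerSeries.mk fun n =>
    algebraMap ℚ R ((-1) ^ i / (i.factorial : ℚ)) *
      ∑ C : RootedChordDiagram n,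
        if C.IsConnected ∧ i ≤ C.b then C.monomial f * f (C.b - i) else 0

/-- `G(x, L) = 1 - ∑_{k ≥ 1} γ_k(x) L^k`, a power series in `L` whose coefficients are power series
in `x`. -/
def greenSeries (γ : ℕ → R⟦X⟧) : R⟦X⟧⟦X⟧ :=
  1 - PowerSeries.mk fun k => if 1 ≤ k then γ k else 0

/-- `e^{-Lρ}` as a power series in `ρ` whose coefficients are series in `x` and `L`. -/
def expNegLRho (R : Type*) [CommRing R] [Algebra ℚ R] : R⟦X⟧⟦X⟧⟦X⟧ :=
  PowerSeries.rescale (-(PowerSeries.X : R⟦X⟧⟦X⟧)) (PowerSeries.exp (R⟦X⟧⟦X⟧))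

/-- The Laurent series `F(ρ) = f_0 / ρ + f_1 + f_2 ρ + ⋯`, with its coefficients viewed as constant
series in `x` and `L`. -/
def laurentF (f : ℕ → R) : (R⟦X⟧⟦X⟧)⸨X⸩ :=
  HahnSeries.single (-1 : ℤ) 1 *
    HahnSeries.ofPowerSeries ℤ (R⟦X⟧⟦X⟧)
      (PowerSeries.mk fun k => PowerSeries.C (PowerSeries.C (f k)))

/-- The operator `∂_{-ρ} = -d/dρ` on power series in `ρ`. -/
def negDeriv {A : Type*} [CommRing A] (Φ : A⟦X⟧) : A⟦X⟧ := -PowerSeries.derivative A Φ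

/-- `Θ = H(x, ∂_{-ρ}) Φ`, where `H(x, D) = ∑_k h_k(x) D^k` is a series in `D` with coefficients
`h_k(x)`: the partial sums of `∑_k h_k(x) ∂_{-ρ}^k Φ` converge formally to `Θ`, that is, the
coefficient of each monomial `x^n L^m ρ^r` is eventually constant with the value it has in `Θ`. -/
def IsOperatorValue (H : R⟦X⟧⟦X⟧) (Φ Θ : R⟦X⟧⟦X⟧⟦X⟧) : Prop :=
  ∀ r m n : ℕ, ∀ᶠ N in Filter.atTop,
    PowerSeries.coeff n (PowerSeries.coeff m (PowerSeries.coeff r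
      (∑ k ∈ Finset.range N,
        PowerSeries.C (PowerSeries.C (PowerSeries.coeff k H)) * negDeriv^[k] Φ))) =
    PowerSeries.coeff n (PowerSeries.coeff m (PowerSeries.coeff r Θ))

/-- `G(x, L)` is a formal solution of the Dyson–Schwinger equation
`G(x, L) = 1 - x G(x, ∂_{-ρ})⁻¹ (e^{-Lρ} - 1) F(ρ) |_{ρ = 0}`. Here `H` is `G(x, D)⁻¹`, `Φ` is
`(e^{-Lρ} - 1) F(ρ)`, which has no pole at `ρ = 0`, and `Θ` is `G(x, ∂_{-ρ})⁻¹ Φ`. -/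
def IsSolution (f : ℕ → R) (G : R⟦X⟧⟦X⟧) : Prop :=
  ∃ (H : R⟦X⟧⟦X⟧) (Φ Θ : R⟦X⟧⟦X⟧⟦X⟧),
    G * H = 1 ∧
    HahnSeries.ofPowerSeries ℤ (R⟦X⟧⟦X⟧) Φ =
      HahnSeries.ofPowerSeries ℤ (R⟦X⟧⟦X⟧) (expNegLRho R - 1) * laurentF f ∧
    IsOperatorValue H Φ Θ ∧
    G = 1 - PowerSeries.C (PowerSeries.X : R⟦X⟧) * PowerSeries.constantCoeff Θ

end DysonSchwinger

end

/-! In a connected diagram `C` with at least two chords, let `C₂` be the component of the chord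
through the point next to the root once the root chord is deleted, and let `C₁` be everything else,
including the root chord (the root share decomposition of Nijenhuis and Wilf). Connectedness forces
the points of `C₁` other than the root to be consecutive, so `C` is recovered by inserting them in
one of the `2 |C₂| - 1` gaps between the points of `C₂`. The intersection order of `C` lists the
root chord, then `C₂`, then the rest of `C₁`. Hence `b(C) = b(C₂) + 1` and
`f_C = f_{b(C₁) - 1} f_{C₁} f_{C₂}`.

With `θ = 2 x d/dx` and `P = ∑ f_{b(C) - 1} f_C x^{|C|}`, this gives, for every sequence `g`,
`∑ g(b(C)) f_C x^{|C|} = g(1) x + P (θ - 1) ∑ g(b(C) + 1) f_C x^{|C|}`.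
Put `h_k = ((-1)^k / k!) ∑_{b(C) = k + 1} f_C x^{|C| - 1}` and `H = ∑ h_k L^k`. The recursion says
that `∂_L G = -P (θ - 1) G` and `∂_L H = -P (θ + 1) H`. Since `θ` is a derivation,
`∂_L (G H) = -P θ (G H)`, which forces `G H = 1`.

At `ρ = 0` the operator `∂_{-ρ}^k` multiplies the coefficient of `ρ^k` by `(-1)^k k!`, which cancels
the factor of `h_k`. The equation then regroups the sum defining `γ_m` by the value of `b(C)`.
-/

noncomputable section

/-! ### Words recording which chords are terminal -/

namespace TerminalWord

variable {R : Type*} [CommRing R] (f : ℕ → R)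

/-- The weight of a word which is read when the last `true` is `d + 1` letters behind: a factor
`f 0` for each `false`, and for each `true` a factor `f δ`, where `δ` is its distance to the
previous `true`. -/
def weightFrom : ℕ → List Bool → R
  | _, [] => 1
  | d, true :: t => f (d + 1) * weightFrom 0 t
  | d, false :: t => f 0 * weightFrom (d + 1) t

/-- The weight of a word on its own: as in `weightFrom`, but without a factor for the first
`true`. On the word of a chord diagram this is the monomial `f_C`. -/
def weight : List Bool → R
  | [] => 1
  | true :: t => weightFrom f 0 t
  | false :: t => f 0 * weight t

theorem weightFrom_append {w : List Bool} (hw : [true] <:+ w) (t : List Bool) (d : ℕ) :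
    weightFrom f d (w ++ t) = weightFrom f d w * weightFrom f 0 t := by
  induction w generalizing d with
  | nil => simp at hw
  | cons x w ih =>
    rcases List.suffix_cons_iff.1 hw with h | h
    · obtain ⟨rfl, rfl⟩ := List.cons_eq_cons.1 h
      simp [weightFrom]
    · cases x <;> simp only [List.cons_append, weightFrom, ih h, mul_assoc]

theorem weight_append {w : List Bool} (hw : [true] <:+ w) (t : List Bool) :
    weight f (w ++ t) = weight f w * weightFrom f 0 t := by
  induction w with
  | nil => simp at hw
  | cons x w ih =>
    rcases List.suffix_cons_iff.1 hw with h | h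
    · obtain ⟨rfl, rfl⟩ := List.cons_eq_cons.1 h
      simp [weight, weightFrom]
    · cases x <;> simp only [List.cons_append, weight, ih h, weightFrom_append f h, mul_assoc]

theorem weightFrom_eq_mul_weight {w : List Bool} (hw : true ∈ w) (d : ℕ) :
    weightFrom f d w = f (d + w.idxOf true + 1) * weight f w := by
  induction w generalizing d with
  | nil => simp at hw
  | cons x w ih =>
    cases x
    · rw [weightFrom, weight, ih (by simpa using hw), List.idxOf_cons_ne _ (by decide),
        mul_left_comm, show d + 1 + w.idxOf true + 1 = d + (w.idxOf true).succ + 1 by omega]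
    · simp [weightFrom, weight]

theorem mul_weightFrom_tail {x : Bool} {t : List Bool} (hw : true ∈ x :: t) :
    f 0 * weightFrom f 0 t = f ((x :: t).idxOf true) * weight f (x :: t) := by
  cases x
  · rw [weight, weightFrom_eq_mul_weight f (by simpa using hw), List.idxOf_cons_ne _ (by decide),
      zero_add, mul_left_comm]
  · simp [weight]

theorem headD_findIdxs {w : List Bool} (hw : true ∈ w) (k : ℕ) :
    (w.findIdxs id k).headD 0 = w.idxOf true + k := by
  induction w generalizing k with
  | nil => simp at hw
  | cons x w ih =>
    cases x
    · rw [List.findIdxs_cons, id, if_neg (by decide), ih (by simpa using hw),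
        List.idxOf_cons_ne _ (by decide)]
      omega
    · simp [List.findIdxs_cons]

theorem weightFrom_eq_prod_gaps (p d : ℕ) (w : List Bool) :
    f 0 ^ w.count false * ((List.zipWith (fun i j => j - i) (p :: w.findIdxs id (p + d + 1))
      (w.findIdxs id (p + d + 1))).map f).prod = weightFrom f d w := by
  induction w generalizing p d with
  | nil => simp [weightFrom]
  | cons x w ih =>
    cases x
    · simp only [weightFrom, ← ih p (d + 1), List.findIdxs_cons, id, List.count_cons_self, pow_succ,
        add_assoc, Bool.false_eq_true, if_false]
      ring
    · simp only [weightFrom, ← ih (p + d + 1) 0, List.findIdxs_cons, id, if_true,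
        List.zipWith_cons_cons, List.map_cons, List.prod_cons, add_zero,
        show p + d + 1 - p = d + 1 by omega, List.count_cons_of_ne (show true ≠ false by decide)]
      ring

theorem weight_eq_prod_gaps (k : ℕ) (w : List Bool) :
    f 0 ^ w.count false * ((List.zipWith (fun i j => j - i) (w.findIdxs id k)
      (w.findIdxs id k).tail).map f).prod = weight f w := by
  induction w generalizing k with
  | nil => simp [weight]
  | cons x w ih =>
    cases x
    · simp only [weight, ← ih (k + 1), List.findIdxs_cons, id, List.count_cons_self, pow_succ,
        Bool.false_eq_true, if_false]
      ring
    · simpa [List.findIdxs_cons, weight] using weightFrom_eq_prod_gaps f k 0 w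

theorem map_idxOf_filter {α : Type*} [BEq α] [LawfulBEq α] (p : α → Bool) {l : List α}
    (hl : l.Nodup) (k : ℕ) :
    (l.filter p).map (fun c => l.idxOf c + k) = (l.map p).findIdxs id k := by
  induction l generalizing k with
  | nil => simp
  | cons x l ih =>
    obtain ⟨hx, hl⟩ := List.nodup_cons.1 hl
    have map_tail : (l.filter p).map (fun c => (x :: l).idxOf c + k) =
        (l.map p).findIdxs id (k + 1) := by
      rw [← ih hl]
      refine List.map_congr_left fun c hc => ?_
      have hxc : x ≠ c := fun e => hx (e ▸ (List.mem_filter.1 hc).1)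
      rw [List.idxOf_cons_ne _ hxc]
      omega
    cases hp : p x <;> simp [hp, List.findIdxs_cons, map_tail]

end TerminalWord

namespace RootedChordDiagram

/-! ### Components and the intersection order -/

section Order

variable {n : ℕ} {C : RootedChordDiagram n}

theorem mem_component_of_adj {S : Finset C.Chord} {v a b : C.Chord} (ha : a ∈ C.component S v)
    (hb : b ∈ S) (hab : C.intersectionGraph.Adj a b) : b ∈ C.component S v := by
  obtain ⟨-, hv, ha, hva⟩ := Finset.mem_filter.1 ha
  exact Finset.mem_filter.2 ⟨hb, hv, hb, hva.trans (SimpleGraph.Adj.reachable hab)⟩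

theorem component_induction {S : Finset C.Chord} {v : C.Chord}
    {motive : (w : C.Chord) → w ∈ C.component S v → Prop}
    (base : ∀ hv : v ∈ C.component S v, motive v hv)
    (step : ∀ a b ha hb, C.intersectionGraph.Adj a b → motive a ha → motive b hb)
    {w : C.Chord} (hw : w ∈ C.component S v) : motive w hw := by
  obtain ⟨-, hv, hw', hvw⟩ := Finset.mem_filter.1 hw
  suffices ∀ w : (S : Set C.Chord), (C.intersectionGraph.induce (S : Set C.Chord)).Reachable
      ⟨v, hv⟩ w → ∃ hw, motive w.1 hw from (this ⟨w, hw'⟩ hvw).2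
  intro w hvw
  rw [SimpleGraph.reachable_iff_reflTransGen] at hvw
  induction hvw with
  | refl => exact ⟨C.mem_component_self hv, base _⟩
  | @tail a b _ hab ih =>
    obtain ⟨ha, motive_a⟩ := ih
    exact ⟨mem_component_of_adj ha b.2 hab, step _ _ ha _ hab motive_a⟩

theorem component_mono {S T : Finset C.Chord} (hST : S ⊆ T) (v : C.Chord) :
    C.component S v ⊆ C.component T v := by
  intro w hw
  induction hw using component_induction with
  | base hv => exact C.mem_component_self (hST (C.component_subset _ _ hv))
  | step a b _ hb hab ih => exact mem_component_of_adj ih (hST (C.component_subset _ _ hb)) hab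

theorem component_component (S : Finset C.Chord) (v : C.Chord) :
    C.component (C.component S v) v = C.component S v := by
  refine Finset.Subset.antisymm (C.component_subset _ _) fun w hw => ?_
  induction hw using component_induction with
  | base h => exact C.mem_component_self h
  | step a b _ hb hab ih => exact mem_component_of_adj ih hb hab

theorem isConnected_iff_component_univ (v : C.Chord) :
    C.IsConnected ↔ C.component Finset.univ v = Finset.univ := by
  have hv := C.mem_component_self (Finset.mem_univ v)
  rw [IsConnected, SimpleGraph.connected_iff_exists_forall_reachable]
  refine ⟨fun ⟨u, hu⟩ => Finset.eq_univ_of_forall fun w => ?_, fun h => ⟨v, fun w => ?_⟩⟩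
  · have hvw := (hu v).symm.trans (hu w)
    rw [SimpleGraph.reachable_iff_reflTransGen] at hvw
    induction hvw with
    | refl => exact hv
    | tail _ hab ha => exact mem_component_of_adj ha (Finset.mem_univ _) hab
  · have hw : w ∈ C.component Finset.univ v := by simp [h]
    induction hw using component_induction with
    | base => exact SimpleGraph.Reachable.refl v
    | step a b _ _ hab ih => exact ih.trans hab.reachable

theorem IsConnected.component_univ (hC : C.IsConnected) (v : C.Chord) :
    C.component Finset.univ v = Finset.univ :=
  (isConnected_iff_component_univ v).1 hC

theorem IsConnected.component_compl_component (hC : C.IsConnected) (r m : C.Chord) :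
    C.component (C.component (Finset.univ.erase r) m)ᶜ r =
      (C.component (Finset.univ.erase r) m)ᶜ := by
  set K := C.component (Finset.univ.erase r) m
  have hr : r ∈ C.component Kᶜ r := C.mem_component_self <| Finset.mem_compl.2 fun h =>
    Finset.notMem_erase r _ (C.component_subset _ _ h)
  suffices h : ∀ w, w ∈ K ∨ w ∈ C.component Kᶜ r from
    Finset.Subset.antisymm (C.component_subset _ _) fun w hw =>
      (h w).resolve_left (Finset.mem_compl.1 hw)
  intro w
  have hw : w ∈ C.component Finset.univ r := by simp [hC.component_univ]
  induction hw using component_induction with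
  | base => exact Or.inr hr
  | step a b _ _ hab ih =>
    by_cases hb : b ∈ K
    · exact Or.inl hb
    by_cases hbr : b = r
    · exact Or.inr (hbr ▸ hr)
    refine Or.inr (mem_component_of_adj (ih.resolve_left fun ha => hb ?_) (by simpa using hb) hab)
    exact mem_component_of_adj ha (by simpa using hbr) hab

variable (C)

theorem orderOn_empty : C.orderOn ∅ = [] := by
  rw [orderOn, dif_neg Finset.not_nonempty_empty]

theorem orderOn_of_nonempty {S : Finset C.Chord} (hS : S.Nonempty) :
    C.orderOn S = S.min' hS :: (C.orderOn ((C.component S (S.min' hS)).erase (S.min' hS)) ++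
      C.orderOn (S \ C.component S (S.min' hS))) := by
  rw [orderOn, dif_pos hS]

theorem orderOn_eq_append {S : Finset C.Chord} (hS : S.Nonempty) :
    C.orderOn S = C.orderOn (C.component S (S.min' hS)) ++
      C.orderOn (S \ C.component S (S.min' hS)) := by
  have hm := C.mem_component_self (S.min'_mem hS)
  have hK : (C.component S (S.min' hS)).Nonempty := ⟨_, hm⟩
  have hmin : (C.component S (S.min' hS)).min' hK = S.min' hS :=
    le_antisymm (Finset.min'_le _ _ hm)
      (Finset.min'_le _ _ (C.component_subset _ _ (Finset.min'_mem _ _)))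
  rw [C.orderOn_of_nonempty hS, C.orderOn_of_nonempty hK, hmin,
    component_component, Finset.sdiff_self, orderOn_empty, List.append_nil,
    List.cons_append]

variable {C} in
theorem IsConnected.intersectionOrder_eq_cons (hC : C.IsConnected) {v : C.Chord}
    (hv : ∀ w, v ≤ w) : C.intersectionOrder = v :: C.orderOn (Finset.univ.erase v) := by
  have huniv : (Finset.univ : Finset C.Chord).Nonempty := ⟨v, Finset.mem_univ _⟩
  have hmin : Finset.univ.min' huniv = v :=
    le_antisymm (Finset.min'_le _ _ (Finset.mem_univ _)) (hv _)
  rw [intersectionOrder, C.orderOn_of_nonempty huniv, hmin, hC.component_univ, Finset.sdiff_self,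
    orderOn_empty, List.append_nil]

theorem mem_orderOn (S : Finset C.Chord) (c : C.Chord) : c ∈ C.orderOn S ↔ c ∈ S := by
  induction S using orderOn.induct C with
  | case1 S hS ih_component ih_rest =>
    have hm := S.min'_mem hS
    have hsub : c ∈ C.component S (S.min' hS) → c ∈ S := fun h => C.component_subset _ _ h
    rw [C.orderOn_of_nonempty hS, List.mem_cons, List.mem_append, ih_component, ih_rest,
      Finset.mem_erase, Finset.mem_sdiff]
    grind
  | case2 S hS => simp [Finset.not_nonempty_iff_eq_empty.1 hS, orderOn_empty]

theorem nodup_orderOn (S : Finset C.Chord) : (C.orderOn S).Nodup := by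
  induction S using orderOn.induct C with
  | case1 S hS ih_component ih_rest =>
    have hm := C.mem_component_self (S.min'_mem hS)
    rw [C.orderOn_of_nonempty hS, List.nodup_cons, List.nodup_append']
    refine ⟨by simp [mem_orderOn, hm], ih_component, ih_rest, fun c hc hc' => ?_⟩
    rw [mem_orderOn] at hc hc'
    exact (Finset.mem_sdiff.1 hc').2 (Finset.mem_of_mem_erase hc)
  | case2 S hS => simp [Finset.not_nonempty_iff_eq_empty.1 hS, orderOn_empty]

/-- The word which records, along the intersection order, whether each chord is terminal. Both
statistics `b` and `monomial` depend on the diagram only through this word. -/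
def word : List Bool := C.intersectionOrder.map fun c => decide (C.IsTerminal c)

theorem terminalLabels_eq_findIdxs : C.terminalLabels = C.word.findIdxs id 1 :=
  TerminalWord.map_idxOf_filter (fun c => decide (C.IsTerminal c)) (C.nodup_orderOn _) 1

variable {C} in
theorem b_eq_idxOf (h : true ∈ C.word) : C.b = C.word.idxOf true + 1 := by
  rw [b, terminalLabels_eq_findIdxs, TerminalWord.headD_findIdxs h]

end Order

/-! ### Endpoints of chords -/
/-- The number of the first endpoint of a chord, as a natural number so that `omega` can compare
endpoints. -/
def Chord.lo {n : ℕ} {C : RootedChordDiagram n} (c : C.Chord) : ℕ := c.1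

/-- The number of the second endpoint of a chord. -/
def Chord.hi {n : ℕ} {C : RootedChordDiagram n} (c : C.Chord) : ℕ := C.partner c.1

open Chord

section Endpoints

variable {n : ℕ} {C : RootedChordDiagram n}

theorem lo_lt_hi (c : C.Chord) : lo c < hi c := c.2

theorem hi_lt (c : C.Chord) : hi c < 2 * n := (C.partner c.1).2

theorem edge_iff {a b : C.Chord} : C.Edge a b ↔ lo a < lo b ∧ lo b < hi a ∧ hi a < hi b := Iff.rfl

theorem adj_iff {a b : C.Chord} : C.intersectionGraph.Adj a b ↔
    (lo a < lo b ∧ lo b < hi a ∧ hi a < hi b) ∨ (lo b < lo a ∧ lo a < hi b ∧ hi b < hi a) :=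
  Iff.rfl

theorem partner_injective : Function.Injective C.partner :=
  Function.Involutive.injective C.partner_partner

theorem lo_injective : Function.Injective (lo : C.Chord → ℕ) :=
  Fin.val_injective.comp Subtype.val_injective

theorem hi_injective : Function.Injective (hi : C.Chord → ℕ) :=
  Fin.val_injective.comp (partner_injective.comp Subtype.val_injective)

theorem lo_ne_hi (c d : C.Chord) : lo c ≠ hi d := by
  intro h
  have hcd : c.1 = C.partner d.1 := Fin.ext h
  have hc := c.2
  rw [hcd, C.partner_partner] at hc
  exact lt_asymm hc d.2

theorem endpoints_ne {c d : C.Chord} (h : c ≠ d) :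
    lo c ≠ lo d ∧ lo c ≠ hi d ∧ hi c ≠ lo d ∧ hi c ≠ hi d :=
  ⟨lo_injective.ne h, lo_ne_hi c d, (lo_ne_hi d c).symm, hi_injective.ne h⟩

/-- The points that are endpoints of the chords in `S`. -/
def points (S : Finset C.Chord) : Finset (Fin (2 * n)) :=
  S.image (fun c => c.1) ∪ S.image (fun c => C.partner c.1)

theorem mem_points {S : Finset C.Chord} {p : Fin (2 * n)} :
    p ∈ points S ↔ ∃ c ∈ S, p = c.1 ∨ p = C.partner c.1 := by
  simp only [points, Finset.mem_union, Finset.mem_image]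
  grind

theorem val_mem_points {S : Finset C.Chord} {c : C.Chord} : c.1 ∈ points S ↔ c ∈ S := by
  refine ⟨fun h => ?_, fun h => mem_points.2 ⟨c, h, Or.inl rfl⟩⟩
  obtain ⟨d, hd, h | h⟩ := mem_points.1 h
  · exact Subtype.ext h ▸ hd
  · exact absurd (congrArg Fin.val h) (lo_ne_hi c d)

theorem partner_mem_points {S : Finset C.Chord} {p : Fin (2 * n)} :
    C.partner p ∈ points S ↔ p ∈ points S := by
  have partner_mem (q : Fin (2 * n)) (hq : q ∈ points S) : C.partner q ∈ points S := by
    obtain ⟨c, hc, rfl | rfl⟩ := mem_points.1 hq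
    · exact mem_points.2 ⟨c, hc, Or.inr rfl⟩
    · exact mem_points.2 ⟨c, hc, Or.inl (C.partner_partner _)⟩
  exact ⟨fun h => C.partner_partner p ▸ partner_mem _ h, partner_mem p⟩

theorem points_injective : Function.Injective (points : Finset C.Chord → Finset (Fin (2 * n))) :=
  fun S T h => by ext c; rw [← val_mem_points, h, val_mem_points]

theorem card_points (S : Finset C.Chord) : (points S).card = 2 * S.card := by
  have hdisjoint : Disjoint (S.image fun c => c.1) (S.image fun c => C.partner c.1) := by
    simp only [Finset.disjoint_left, Finset.mem_image]
    rintro _ ⟨c, -, rfl⟩ ⟨d, -, h⟩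
    exact lo_ne_hi c d (congrArg Fin.val h.symm)
  have hinjective : Function.Injective fun c : C.Chord => C.partner c.1 :=
    partner_injective.comp Subtype.val_injective
  rw [points, Finset.card_union_of_disjoint hdisjoint,
    Finset.card_image_of_injective S Subtype.val_injective,
    Finset.card_image_of_injective S hinjective, two_mul]

variable (C) in
theorem exists_chord (p : Fin (2 * n)) : ∃ c : C.Chord, p = c.1 ∨ p = C.partner c.1 := by
  rcases lt_or_gt_of_ne (C.partner_ne p) with h | h
  · exact ⟨⟨C.partner p, by rwa [C.partner_partner]⟩, Or.inr (C.partner_partner p).symm⟩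
  · exact ⟨⟨p, h⟩, Or.inl rfl⟩

theorem points_univ : points (Finset.univ : Finset C.Chord) = Finset.univ :=
  Finset.eq_univ_of_forall fun p => mem_points.2 <| by simpa using C.exists_chord p

theorem mem_points_compl {S : Finset C.Chord} {p : Fin (2 * n)} :
    p ∈ points Sᶜ ↔ p ∉ points S := by
  obtain ⟨c, rfl | rfl⟩ := C.exists_chord p <;>
    simp only [partner_mem_points, val_mem_points, Finset.mem_compl]

variable (C)

theorem card_chord : Fintype.card C.Chord = n := by
  have h := card_points (Finset.univ : Finset C.Chord)
  rw [points_univ, Finset.card_univ, Finset.card_univ, Fintype.card_fin] at h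
  omega

theorem length_word : C.word.length = n := by
  have htoFinset : (C.orderOn Finset.univ).toFinset = Finset.univ := by ext c; simp [mem_orderOn]
  rw [word, intersectionOrder, List.length_map, ← List.toFinset_card_of_nodup (C.nodup_orderOn _),
    htoFinset, Finset.card_univ, card_chord]

variable {C} in
theorem monomial_eq_weight {R : Type*} [CommRing R] (f : ℕ → R) (hC : true ∈ C.word) :
    C.monomial f = TerminalWord.weight f C.word := by
  have length_gaps : C.gaps.length = C.word.count true - 1 := by
    rw [gaps, terminalLabels_eq_findIdxs, List.length_zipWith, List.length_tail,
      List.length_findIdxs, List.count, show (id : Bool → Bool) = (· == true) by ext; simp]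
    omega
  have hpos : 0 < C.word.count true := List.count_pos_iff.2 hC
  have hcount := C.word.count_true_add_count_false
  rw [C.length_word] at hcount
  rw [← TerminalWord.weight_eq_prod_gaps f 1, monomial, length_gaps, gaps,
    terminalLabels_eq_findIdxs, show n - (C.word.count true - 1) - 1 = C.word.count false by omega]

end Endpoints

/-! ### Embeddings of chord diagrams -/

/-- An order-preserving map `φ` of points that sends chords of `D` to chords of `C`. -/
structure IsEmbedding {m n : ℕ} (D : RootedChordDiagram m) (C : RootedChordDiagram n)
    (φ : Fin (2 * m) → Fin (2 * n)) : Prop where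
  strictMono : StrictMono φ
  partner : ∀ p, C.partner (φ p) = φ (D.partner p)

namespace IsEmbedding

variable {m n : ℕ} {D D' : RootedChordDiagram m} {C : RootedChordDiagram n}
  {φ : Fin (2 * m) → Fin (2 * n)}

theorem unique (hφ : IsEmbedding D C φ) (hφ' : IsEmbedding D' C φ) : D = D' := by
  ext1
  funext p
  exact hφ.strictMono.injective ((hφ.partner p).symm.trans (hφ'.partner p))

variable (hφ : IsEmbedding D C φ)

/-- The map induced on chords by an embedding of diagrams. -/
def chordMap : D.Chord ↪o C.Chord :=
  OrderEmbedding.ofStrictMono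
    (fun c => ⟨φ c.1, by rw [hφ.partner]; exact hφ.strictMono c.2⟩)
    (fun _ _ h => hφ.strictMono h)

theorem lo_chordMap (c : D.Chord) : lo (hφ.chordMap c) = φ c.1 := rfl

theorem hi_chordMap (c : D.Chord) : hi (hφ.chordMap c) = φ (D.partner c.1) :=
  congrArg Fin.val (hφ.partner c.1)

theorem edge_chordMap {a b : D.Chord} :
    C.Edge (hφ.chordMap a) (hφ.chordMap b) ↔ D.Edge a b := by
  rw [edge_iff, lo_chordMap, lo_chordMap, hi_chordMap, hi_chordMap]
  simp only [Fin.val_fin_lt, hφ.strictMono.lt_iff_lt]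
  rfl

theorem adj_chordMap {a b : D.Chord} :
    C.intersectionGraph.Adj (hφ.chordMap a) (hφ.chordMap b) ↔ D.intersectionGraph.Adj a b :=
  or_congr hφ.edge_chordMap hφ.edge_chordMap

theorem reachable_chordMap (hD : D.IsConnected) (a b : D.Chord) :
    C.intersectionGraph.Reachable (hφ.chordMap a) (hφ.chordMap b) :=
  (hD.preconnected a b).map ⟨hφ.chordMap, hφ.adj_chordMap.2⟩

theorem component_map (S : Finset D.Chord) (v : D.Chord) :
    C.component (S.map hφ.chordMap.toEmbedding) (hφ.chordMap v) =
      (D.component S v).map hφ.chordMap.toEmbedding := by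
  ext w
  constructor
  · intro hw
    induction hw using component_induction with
    | base hv =>
      have hvS := C.component_subset _ _ hv
      exact Finset.mem_map_of_mem _ (D.mem_component_self (by simpa using hvS))
    | step a b _ hb hab ih =>
      obtain ⟨x, hx, rfl⟩ := Finset.mem_map.1 ih
      obtain ⟨y, hy, rfl⟩ := Finset.mem_map.1 (C.component_subset _ _ hb)
      exact Finset.mem_map_of_mem _ (mem_component_of_adj hx hy (hφ.adj_chordMap.1 hab))
  · intro hw
    obtain ⟨x, hx, rfl⟩ := Finset.mem_map.1 hw
    clear hw
    induction hx using component_induction with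
    | base hv =>
      exact C.mem_component_self (Finset.mem_map_of_mem _ (D.component_subset _ _ hv))
    | step a b _ hb hab ih =>
      exact mem_component_of_adj ih (Finset.mem_map_of_mem _ (D.component_subset _ _ hb))
        (hφ.adj_chordMap.2 hab)

theorem isConnected_of_map_univ_eq_component {S : Finset C.Chord} {v : C.Chord} (hv : v ∈ S)
    (hS : Finset.univ.map hφ.chordMap.toEmbedding = C.component S v) : D.IsConnected := by
  obtain ⟨u, -, rfl⟩ := Finset.mem_map.1 (hS ▸ C.mem_component_self hv)
  rw [isConnected_iff_component_univ u, ← Finset.map_inj (f := hφ.chordMap.toEmbedding),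
    ← hφ.component_map, hS]
  exact component_component _ _

theorem points_map_univ :
    (points (Finset.univ.map hφ.chordMap.toEmbedding) : Set (Fin (2 * n))) = Set.range φ := by
  ext p
  rw [Finset.mem_coe, mem_points]
  constructor
  · rintro ⟨c, hc, hpc⟩
    obtain ⟨d, -, rfl⟩ := Finset.mem_map.1 hc
    obtain rfl | rfl := hpc
    · exact ⟨d.1, rfl⟩
    · exact ⟨D.partner d.1, (hφ.partner _).symm⟩
  · rintro ⟨q, rfl⟩
    obtain ⟨d, rfl | rfl⟩ := D.exists_chord q
    · exact ⟨_, Finset.mem_map_of_mem _ (Finset.mem_univ d), Or.inl rfl⟩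
    · exact ⟨_, Finset.mem_map_of_mem _ (Finset.mem_univ d), Or.inr (hφ.partner _).symm⟩

theorem exists_of_range_eq_points (hmono : StrictMono φ) {S : Finset C.Chord}
    (hrange : Set.range φ = points S) :
    ∃ (D : RootedChordDiagram m) (h : IsEmbedding D C φ),
      Finset.univ.map h.chordMap.toEmbedding = S := by
  have partner_mem_range (p : Fin (2 * m)) : C.partner (φ p) ∈ Set.range φ := by
    rw [hrange, Finset.mem_coe, partner_mem_points, ← Finset.mem_coe, ← hrange]
    exact Set.mem_range_self p
  choose g hg using partner_mem_range
  have h : IsEmbedding ⟨g, fun p => hmono.injective (by rw [hg, hg, C.partner_partner]),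
      fun p hp => C.partner_ne (φ p) (by rw [← hg, hp])⟩ C φ := ⟨hmono, fun p => (hg p).symm⟩
  exact ⟨_, h, points_injective (Finset.coe_injective (h.points_map_univ.trans hrange))⟩

theorem orderOn_map (S : Finset D.Chord) :
    C.orderOn (S.map hφ.chordMap.toEmbedding) = (D.orderOn S).map hφ.chordMap := by
  induction S using orderOn.induct D with
  | case1 S hS ih_component ih_rest =>
    have hmap : (S.map hφ.chordMap.toEmbedding).Nonempty := hS.map
    have hmin : (S.map hφ.chordMap.toEmbedding).min' hmap = hφ.chordMap (S.min' hS) := by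
      refine le_antisymm (Finset.min'_le _ _ (Finset.mem_map_of_mem _ (S.min'_mem hS)))
        (Finset.le_min' _ _ _ fun y hy => ?_)
      obtain ⟨x, hx, rfl⟩ := Finset.mem_map.1 hy
      exact hφ.chordMap.monotone (Finset.min'_le _ _ hx)
    have herase : ((D.component S (S.min' hS)).map hφ.chordMap.toEmbedding).erase
        (hφ.chordMap (S.min' hS)) =
        ((D.component S (S.min' hS)).erase (S.min' hS)).map hφ.chordMap.toEmbedding :=
      (Finset.map_erase _ _ _).symm
    rw [D.orderOn_of_nonempty hS, C.orderOn_of_nonempty hmap, hmin, hφ.component_map,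
      ← Finset.map_sdiff, herase, ih_component, ih_rest, List.map_cons, List.map_append]
  | case2 S hS => simp [Finset.not_nonempty_iff_eq_empty.1 hS, orderOn_empty]

end IsEmbedding

/-! ### The root chord -/

section Root

variable {n : ℕ} (C : RootedChordDiagram n)

/-- The chord through the root. -/
def root (hn : 0 < n) : C.Chord :=
  ⟨⟨0, by omega⟩, lt_of_le_of_ne (Fin.le_def.2 (Nat.zero_le _)) (C.partner_ne _).symm⟩

theorem lo_root (hn : 0 < n) : lo (C.root hn) = 0 := rfl

theorem root_le (hn : 0 < n) (c : C.Chord) : C.root hn ≤ c :=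
  Fin.le_def.2 (Nat.zero_le _)

variable {C}

theorem lo_pos {hn : 0 < n} {c : C.Chord} (hc : c ≠ C.root hn) : 0 < lo c :=
  Nat.pos_of_ne_zero (endpoints_ne hc).1

theorem IsConnected.pos (hC : C.IsConnected) : 0 < n := by
  obtain ⟨c⟩ := hC.nonempty
  have := c.1.2
  omega

theorem IsConnected.exists_lo_lt_le_hi (hC : C.IsConnected) {j : ℕ} (hj_pos : 0 < j)
    (hj : j < 2 * n) : ∃ c : C.Chord, lo c < j ∧ j ≤ hi c := by
  by_contra! hcon
  have hi_lt_slot : ∀ w ∈ C.component Finset.univ (C.root hC.pos), hi w < j := by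
    intro w hw
    induction hw using component_induction with
    | base => exact hcon _ hj_pos
    | step a b _ _ hab ih =>
      have hb := hcon b
      have ha := lo_lt_hi a
      rw [adj_iff] at hab
      omega
  obtain ⟨u, hu⟩ := C.exists_chord ⟨2 * n - 1, by omega⟩
  have hu : 2 * n - 1 = lo u ∨ 2 * n - 1 = hi u := hu.imp (congrArg Fin.val) (congrArg Fin.val)
  have hu_lt := hi_lt_slot u (by simp [hC.component_univ])
  have hu_lo := lo_lt_hi u
  omega

end Root

/-! ### Inserting a diagram into another one -/

/-- The sizes `a`, `b` and the slot `j` for which a diagram with `a` chords can be inserted between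
the points `j - 1` and `j` of a diagram with `b` chords to give a diagram with `n` chords. The root
of the inserted diagram is then moved in front of all the points. -/
structure IsSlot (n a b j : ℕ) : Prop where
  pos_left : 0 < a
  pos_slot : 0 < j
  slot_lt : j < 2 * b
  add_eq : a + b = n

theorem IsSlot.pos {n a b j : ℕ} (h : IsSlot n a b j) : 0 < n := by
  obtain ⟨ha, -, -, hab⟩ := h
  omega

theorem IsSlot.pos_right {n a b j : ℕ} (h : IsSlot n a b j) : 0 < b := by
  have := h.slot_lt
  omega

section Insertion

variable {n a b j : ℕ} (h : IsSlot n a b j)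

/-- The position after the insertion of the points of the inserted diagram: the root stays first,
the other ones go to the slot. -/
def rootEmb (p : Fin (2 * a)) : Fin (2 * n) :=
  ⟨if p.1 = 0 then 0 else p.1 + j, by
    obtain ⟨ha, -, hjb, hab⟩ := h
    split_ifs <;> omega⟩

/-- The position after the insertion of the points of the diagram that receives it. -/
def shareEmb (p : Fin (2 * b)) : Fin (2 * n) :=
  ⟨if p.1 < j then p.1 + 1 else p.1 + 2 * a, by
    obtain ⟨ha, -, hjb, hab⟩ := h
    split_ifs <;> omega⟩

theorem val_rootEmb (p : Fin (2 * a)) :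
    (rootEmb h p : ℕ) = if p.1 = 0 then 0 else p.1 + j := rfl

theorem val_shareEmb (p : Fin (2 * b)) :
    (shareEmb h p : ℕ) = if p.1 < j then p.1 + 1 else p.1 + 2 * a := rfl

theorem strictMono_rootEmb : StrictMono (rootEmb h) := by
  intro p q hpq
  rw [Fin.lt_def] at hpq ⊢
  rw [val_rootEmb, val_rootEmb]
  split_ifs <;> omega

theorem strictMono_shareEmb : StrictMono (shareEmb h) := by
  intro p q hpq
  have := h.pos_left
  rw [Fin.lt_def] at hpq ⊢
  rw [val_shareEmb, val_shareEmb]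
  split_ifs <;> omega

theorem mem_range_rootEmb {p : Fin (2 * n)} :
    p ∈ Set.range (rootEmb h) ↔ p.1 = 0 ∨ j < p.1 ∧ p.1 < j + 2 * a := by
  have := h.pos_left
  constructor
  · rintro ⟨q, rfl⟩
    have := q.2
    rw [val_rootEmb]
    split_ifs <;> omega
  · rintro (hp | hp)
    · exact ⟨⟨0, by omega⟩, Fin.ext (by rw [val_rootEmb]; simp [hp])⟩
    · refine ⟨⟨p.1 - j, by omega⟩, Fin.ext ?_⟩
      rw [val_rootEmb]
      split_ifs <;> simp_all <;> omega

theorem mem_range_shareEmb {p : Fin (2 * n)} :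
    p ∈ Set.range (shareEmb h) ↔ 0 < p.1 ∧ p.1 ≤ j ∨ j + 2 * a ≤ p.1 := by
  obtain ⟨-, hj, hjb, hab⟩ := id h
  constructor
  · rintro ⟨q, rfl⟩
    have := q.2
    rw [val_shareEmb]
    split_ifs <;> omega
  · rintro (hp | hp)
    · exact ⟨⟨p.1 - 1, by omega⟩, Fin.ext (by rw [val_shareEmb]; grind)⟩
    · exact ⟨⟨p.1 - 2 * a, by omega⟩, Fin.ext (by rw [val_shareEmb]; grind)⟩

theorem mem_range_shareEmb_iff_notMem {p : Fin (2 * n)} :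
    p ∈ Set.range (shareEmb h) ↔ p ∉ Set.range (rootEmb h) := by
  have := h.pos_left
  rw [mem_range_shareEmb, mem_range_rootEmb]
  omega

/-- The points after the insertion are those of the two diagrams. -/
def pointEquiv : Fin (2 * a) ⊕ Fin (2 * b) ≃ Fin (2 * n) :=
  Equiv.ofBijective (Sum.elim (rootEmb h) (shareEmb h)) <| by
    refine ⟨(strictMono_rootEmb h).injective.sumElim (strictMono_shareEmb h).injective
      fun p q e => (mem_range_shareEmb_iff_notMem h).1 ⟨q, rfl⟩ ⟨p, e⟩, fun p => ?_⟩
    by_cases hp : p ∈ Set.range (rootEmb h)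
    · obtain ⟨q, rfl⟩ := hp
      exact ⟨Sum.inl q, rfl⟩
    · obtain ⟨q, rfl⟩ := (mem_range_shareEmb_iff_notMem h).2 hp
      exact ⟨Sum.inr q, rfl⟩

/-- `C` is obtained by inserting `C₁` into the slot `j` of `C₂`. -/
structure IsInsertion (h : IsSlot n a b j) (C₁ : RootedChordDiagram a) (C₂ : RootedChordDiagram b)
    (C : RootedChordDiagram n) : Prop where
  left : IsEmbedding C₁ C (rootEmb h)
  right : IsEmbedding C₂ C (shareEmb h)

/-- The diagram obtained by inserting `C₁` into the slot `j` of `C₂`. -/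
def insertion (C₁ : RootedChordDiagram a) (C₂ : RootedChordDiagram b) : RootedChordDiagram n where
  partner p := pointEquiv h (Sum.map C₁.partner C₂.partner ((pointEquiv h).symm p))
  partner_partner p := by
    obtain ⟨q | q, rfl⟩ := (pointEquiv h).surjective p <;> simp [partner_partner]
  partner_ne p := by
    obtain ⟨q | q, rfl⟩ := (pointEquiv h).surjective p <;> simp [partner_ne]

theorem isInsertion_insertion (C₁ : RootedChordDiagram a) (C₂ : RootedChordDiagram b) :
    IsInsertion h C₁ C₂ (insertion h C₁ C₂) where
  left := ⟨strictMono_rootEmb h, fun p => by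
    change (insertion h C₁ C₂).partner (pointEquiv h (Sum.inl p)) =
      pointEquiv h (Sum.inl (C₁.partner p))
    simp [insertion]⟩
  right := ⟨strictMono_shareEmb h, fun p => by
    change (insertion h C₁ C₂).partner (pointEquiv h (Sum.inr p)) =
      pointEquiv h (Sum.inr (C₂.partner p))
    simp [insertion]⟩

namespace IsInsertion

variable {h} {C₁ : RootedChordDiagram a} {C₂ : RootedChordDiagram b} {C C' : RootedChordDiagram n}

theorem unique (hC : IsInsertion h C₁ C₂ C) (hC' : IsInsertion h C₁ C₂ C') : C = C' := by
  ext1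
  funext p
  obtain ⟨q | q, rfl⟩ := (pointEquiv h).surjective p
  · exact (hC.left.partner q).trans (hC'.left.partner q).symm
  · exact (hC.right.partner q).trans (hC'.right.partner q).symm

variable (hC : IsInsertion h C₁ C₂ C)

theorem exists_chordMap_eq (c : C.Chord) :
    (∃ d, hC.left.chordMap d = c) ∨ ∃ d, hC.right.chordMap d = c := by
  obtain ⟨p, hp⟩ := c
  obtain ⟨q | q, rfl⟩ := (pointEquiv h).surjective p
  · exact Or.inl ⟨⟨q, hC.left.strictMono.lt_iff_lt.1 (hp.trans_eq (hC.left.partner q))⟩, rfl⟩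
  · exact Or.inr ⟨⟨q, hC.right.strictMono.lt_iff_lt.1 (hp.trans_eq (hC.right.partner q))⟩, rfl⟩

theorem chordMap_left_ne_right (c : C₁.Chord) (d : C₂.Chord) :
    hC.left.chordMap c ≠ hC.right.chordMap d := fun e =>
  (mem_range_shareEmb_iff_notMem h).1 ⟨d.1, (congrArg Subtype.val e).symm⟩ ⟨c.1, rfl⟩

theorem chordMap_root : hC.left.chordMap (C₁.root h.pos_left) = C.root h.pos :=
  lo_injective rfl

theorem chordMap_left_eq_root {c : C₁.Chord} :
    hC.left.chordMap c = C.root h.pos ↔ c = C₁.root h.pos_left := by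
  rw [← hC.chordMap_root, hC.left.chordMap.injective.eq_iff]

theorem chordMap_right_ne_root (d : C₂.Chord) : hC.right.chordMap d ≠ C.root h.pos := by
  rw [← hC.chordMap_root]
  exact (hC.chordMap_left_ne_right _ _).symm

theorem lo_chordMap_right_root : lo (hC.right.chordMap (C₂.root h.pos_right)) = 1 := by
  rw [IsEmbedding.lo_chordMap, val_shareEmb]
  exact if_pos h.pos_slot

theorem not_edge_right_left (c : C₁.Chord) (d : C₂.Chord) :
    ¬ C.Edge (hC.right.chordMap d) (hC.left.chordMap c) := by
  rw [edge_iff]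
  simp only [IsEmbedding.lo_chordMap, IsEmbedding.hi_chordMap, val_rootEmb, val_shareEmb]
  split_ifs <;> omega

theorem eq_root_of_edge_left_right {c : C₁.Chord} {d : C₂.Chord}
    (hcd : C.Edge (hC.left.chordMap c) (hC.right.chordMap d)) : c = C₁.root h.pos_left := by
  rw [edge_iff] at hcd
  simp only [IsEmbedding.lo_chordMap, IsEmbedding.hi_chordMap, val_rootEmb, val_shareEmb] at hcd
  refine lo_injective (show c.1.1 = 0 from ?_)
  split_ifs at hcd <;> omega

theorem edge_root_right {d : C₂.Chord} (hd_lo : lo d < j) (hd_hi : j ≤ hi d) :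
    C.Edge (C.root h.pos) (hC.right.chordMap d) := by
  have hpos := lo_lt_hi (C₁.root h.pos_left)
  have hlt := hi_lt (C₁.root h.pos_left)
  rw [lo_root] at hpos
  rw [← hC.chordMap_root, edge_iff]
  simp only [IsEmbedding.lo_chordMap, IsEmbedding.hi_chordMap, val_rootEmb, val_shareEmb]
  change (if lo (C₁.root h.pos_left) = 0 then 0 else _) < (if lo d < j then lo d + 1 else _) ∧
    (if lo d < j then lo d + 1 else _) < (if hi (C₁.root h.pos_left) = 0 then 0 else
      hi (C₁.root h.pos_left) + j) ∧
    (if hi (C₁.root h.pos_left) = 0 then 0 else hi (C₁.root h.pos_left) + j) <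
      (if hi d < j then _ else hi d + 2 * a)
  rw [lo_root, if_pos rfl, if_pos hd_lo, if_neg hpos.ne', if_neg hd_hi.not_gt]
  omega

theorem exists_edge_root (h₂ : C₂.IsConnected) :
    ∃ d, C.Edge (C.root h.pos) (hC.right.chordMap d) := by
  obtain ⟨d, hd_lo, hd_hi⟩ := h₂.exists_lo_lt_le_hi h.pos_slot h.slot_lt
  exact ⟨d, hC.edge_root_right hd_lo hd_hi⟩

theorem isConnected (hC : IsInsertion h C₁ C₂ C) (h₁ : C₁.IsConnected) (h₂ : C₂.IsConnected) :
    C.IsConnected := by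
  obtain ⟨u, hu⟩ := hC.exists_edge_root h₂
  refine SimpleGraph.connected_iff_exists_forall_reachable _ |>.2 ⟨C.root h.pos, fun c => ?_⟩
  obtain ⟨d, rfl⟩ | ⟨d, rfl⟩ := hC.exists_chordMap_eq c
  · exact hC.chordMap_root ▸ hC.left.reachable_chordMap h₁ _ d
  · exact (SimpleGraph.Adj.reachable (Or.inl hu)).trans (hC.right.reachable_chordMap h₂ u d)

theorem component_erase_root (h₂ : C₂.IsConnected) (d : C₂.Chord) :
    C.component (Finset.univ.erase (C.root h.pos)) (hC.right.chordMap d) =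
      Finset.univ.map hC.right.chordMap.toEmbedding := by
  refine Finset.Subset.antisymm (fun w hw => ?_) ?_
  · induction hw using component_induction with
    | base => exact Finset.mem_map_of_mem _ (Finset.mem_univ d)
    | step u v _ hv huv ih =>
      obtain ⟨x, -, rfl⟩ := Finset.mem_map.1 ih
      obtain ⟨y, rfl⟩ | ⟨y, rfl⟩ := hC.exists_chordMap_eq v
      · obtain hxy | hyx := huv
        · exact absurd hxy (hC.not_edge_right_left _ _)
        · exact absurd (hC.chordMap_left_eq_root.2 (hC.eq_root_of_edge_left_right hyx))
            (Finset.ne_of_mem_erase (C.component_subset _ _ hv))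
      · exact Finset.mem_map_of_mem _ (Finset.mem_univ y)
  · rw [← h₂.component_univ d, ← hC.right.component_map]
    refine component_mono (fun w hw => ?_) _
    obtain ⟨x, -, rfl⟩ := Finset.mem_map.1 hw
    exact Finset.mem_erase.2 ⟨hC.chordMap_right_ne_root x, Finset.mem_univ _⟩

theorem isTerminal_right (d : C₂.Chord) :
    C.IsTerminal (hC.right.chordMap d) ↔ C₂.IsTerminal d := by
  refine ⟨fun hd x hx => hd _ (hC.right.edge_chordMap.2 hx), fun hd x hx => ?_⟩
  obtain ⟨y, rfl⟩ | ⟨y, rfl⟩ := hC.exists_chordMap_eq x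
  · exact hC.not_edge_right_left _ _ hx
  · exact hd y (hC.right.edge_chordMap.1 hx)

theorem isTerminal_left {c : C₁.Chord} (hc : c ≠ C₁.root h.pos_left) :
    C.IsTerminal (hC.left.chordMap c) ↔ C₁.IsTerminal c := by
  refine ⟨fun ht x hx => ht _ (hC.left.edge_chordMap.2 hx), fun ht x hx => ?_⟩
  obtain ⟨y, rfl⟩ | ⟨y, rfl⟩ := hC.exists_chordMap_eq x
  · exact ht y (hC.left.edge_chordMap.1 hx)
  · exact hc (hC.eq_root_of_edge_left_right hx)

theorem min'_erase_root (hne : (Finset.univ.erase (C.root h.pos)).Nonempty) :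
    (Finset.univ.erase (C.root h.pos)).min' hne = hC.right.chordMap (C₂.root h.pos_right) := by
  refine le_antisymm (Finset.min'_le _ _ (by simp [hC.chordMap_right_ne_root]))
    (Finset.le_min' _ _ _ fun y hy => ?_)
  change lo (hC.right.chordMap (C₂.root h.pos_right)) ≤ lo y
  rw [hC.lo_chordMap_right_root]
  exact lo_pos (Finset.ne_of_mem_erase hy)

theorem erase_root_sdiff_map_right :
    Finset.univ.erase (C.root h.pos) \ Finset.univ.map hC.right.chordMap.toEmbedding =
      (Finset.univ.erase (C₁.root h.pos_left)).map hC.left.chordMap.toEmbedding := by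
  ext c
  obtain ⟨d, rfl⟩ | ⟨d, rfl⟩ := hC.exists_chordMap_eq c
  · simp [hC.chordMap_left_eq_root, fun x => (hC.chordMap_left_ne_right d x).symm]
  · simp [hC.chordMap_left_ne_right]

theorem intersectionOrder_eq (h₁ : C₁.IsConnected) (h₂ : C₂.IsConnected) :
    C.intersectionOrder = C.root h.pos :: (C₂.intersectionOrder.map hC.right.chordMap ++
      (C₁.orderOn (Finset.univ.erase (C₁.root h.pos_left))).map hC.left.chordMap) := by
  have hne : (Finset.univ.erase (C.root h.pos)).Nonempty :=
    ⟨hC.right.chordMap (C₂.root h.pos_right), by simp [hC.chordMap_right_ne_root]⟩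
  rw [(hC.isConnected h₁ h₂).intersectionOrder_eq_cons (C.root_le h.pos),
    C.orderOn_eq_append hne, hC.min'_erase_root hne, hC.component_erase_root h₂,
    hC.erase_root_sdiff_map_right, hC.right.orderOn_map, hC.left.orderOn_map, intersectionOrder]

theorem word_eq (hC : IsInsertion h C₁ C₂ C) (h₁ : C₁.IsConnected)
    (h₂ : C₂.IsConnected) :
    C.word = false :: (C₂.word ++ C₁.word.tail) := by
  have hroot : ¬ C.IsTerminal (C.root h.pos) := by
    obtain ⟨d, hd⟩ := hC.exists_edge_root h₂
    exact fun ht => ht _ hd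
  rw [word, hC.intersectionOrder_eq h₁ h₂, word, word,
    h₁.intersectionOrder_eq_cons (C₁.root_le h.pos_left)]
  simp only [List.map_cons, List.map_append, List.map_map, List.tail_cons, hroot, decide_false]
  congr 2
  · refine List.map_congr_left fun d _ => ?_
    simp only [Function.comp_apply, hC.isTerminal_right]
  · refine List.map_congr_left fun d hd => ?_
    rw [mem_orderOn] at hd
    simp only [Function.comp_apply, hC.isTerminal_left (Finset.ne_of_mem_erase hd)]

end IsInsertion

end Insertion

/-! ### The root share -/

section Share

variable {n : ℕ} {C : RootedChordDiagram n}

theorem IsConnected.exists_lo_eq_one (hC : C.IsConnected) (hn : 2 ≤ n) :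
    ∃ c : C.Chord, lo c = 1 := by
  obtain ⟨d, hd_lo, hd_hi⟩ := hC.exists_lo_lt_le_hi two_pos (by omega : 2 < 2 * n)
  obtain ⟨c, hc⟩ := C.exists_chord ⟨1, by omega⟩
  obtain hc | hc : 1 = lo c ∨ 1 = hi c := hc.imp (congrArg Fin.val) (congrArg Fin.val)
  · exact ⟨c, hc.symm⟩
  · have hdc : d ≠ c := fun e => by rw [e] at hd_hi; omega
    have hlo := (endpoints_ne hdc).1
    have hlt := lo_lt_hi c
    exact ⟨d, by omega⟩

/-- The chords connected to the chord `m` once the root chord is removed. When `m` is the second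
chord, these are the chords of the root share of Nijenhuis and Wilf. -/
def share (C : RootedChordDiagram n) (hn : 0 < n) (m : C.Chord) : Finset C.Chord :=
  C.component (Finset.univ.erase (C.root hn)) m

variable {hn : 0 < n} {m : C.Chord}

theorem ne_root_of_mem_share {k : C.Chord} (hk : k ∈ C.share hn m) : k ≠ C.root hn :=
  Finset.ne_of_mem_erase (C.component_subset _ _ hk)

theorem mem_share_self (hm : m ≠ C.root hn) : m ∈ C.share hn m :=
  C.mem_component_self (Finset.mem_erase.2 ⟨hm, Finset.mem_univ m⟩)

theorem not_adj_of_mem_share {k c : C.Chord} (hk : k ∈ C.share hn m) (hc : c ∉ C.share hn m)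
    (hcr : c ≠ C.root hn) : ¬ C.intersectionGraph.Adj k c := fun h =>
  hc (mem_component_of_adj hk (Finset.mem_erase.2 ⟨hcr, Finset.mem_univ c⟩) h)

theorem IsConnected.exists_mem_share_hi_root_lt (hC : C.IsConnected) (hm : m ≠ C.root hn) :
    ∃ k ∈ C.share hn m, hi (C.root hn) < hi k := by
  by_contra! hcon
  suffices h : ∀ k ∈ C.component Finset.univ m, k ∈ C.share hn m from
    ne_root_of_mem_share (h (C.root hn) (by simp [hC.component_univ])) rfl
  intro k hk
  induction hk using component_induction with
  | base => exact mem_share_self hm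
  | step a b _ _ hab ih =>
    by_contra hb
    obtain rfl : b = C.root hn := by_contra fun hbr => not_adj_of_mem_share ih hb hbr hab
    have hle := hcon a ih
    have hlo := C.lo_root hn
    rw [adj_iff] at hab
    omega

theorem not_lo_mem_Ioo_of_mem_component {S : Finset C.Chord} {y z : ℕ} (hm : lo m ≤ y)
    (hS : ∀ k ∈ C.component S m, (y < lo k ∧ lo k < z ↔ y < hi k ∧ hi k < z)) {k : C.Chord}
    (hk : k ∈ C.component S m) : ¬ (y < lo k ∧ lo k < z) := by
  induction hk using component_induction with
  | base => omega
  | step a b ha hb hab ih =>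
    have hSa := hS a ha
    have hSb := hS b hb
    rw [adj_iff] at hab
    omega

theorem not_lo_mem_Ioo_of_mem_share (hm : lo m = 1) {k c : C.Chord}
    (hk : k ∈ C.share hn m) (hc : c ∉ C.share hn m) (hcr : c ≠ C.root hn) :
    ¬ (lo c < lo k ∧ lo k < hi c) := by
  refine not_lo_mem_Ioo_of_mem_component (hm.trans_le (lo_pos hcr)) (fun k hk => ?_) hk
  have hadj := not_adj_of_mem_share hk hc hcr
  have hne := endpoints_ne (ne_of_mem_of_not_mem hk hc)
  have hlt := lo_lt_hi k
  rw [adj_iff] at hadj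
  omega

theorem IsConnected.hi_mem_Ioo_iff (hC : C.IsConnected) (hm : lo m = 1) {k c : C.Chord}
    (hk : k ∈ C.share hn m) (hc : c ∉ C.share hn m) : lo k < hi c ∧ hi c < hi k ↔
      lo k < hi (C.root hn) ∧ hi (C.root hn) < hi k := by
  rw [← Finset.mem_compl, share, ← hC.component_compl_component, ← share] at hc
  induction hc using component_induction with
  | base => rfl
  | step a b ha hb hab ih =>
    rw [← ih]
    have noncrossing {d : C.Chord} (hd : d ∈ (C.share hn m)ᶜ) : d = C.root hn ∨
        ¬ C.intersectionGraph.Adj k d ∧ ¬ (lo d < lo k ∧ lo k < hi d) := by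
      refine or_iff_not_imp_left.2 fun hdr => ?_
      rw [Finset.mem_compl] at hd
      exact ⟨not_adj_of_mem_share hk hd hdr, not_lo_mem_Ioo_of_mem_share hm hk hd hdr⟩
    replace ha := C.component_subset _ _ ha
    replace hb := C.component_subset _ _ hb
    have ha_ne := endpoints_ne (ne_of_mem_of_not_mem hk (Finset.mem_compl.1 ha))
    have hb_ne := endpoints_ne (ne_of_mem_of_not_mem hk (Finset.mem_compl.1 hb))
    have hk_lt := lo_lt_hi k
    have ha_lt := lo_lt_hi a
    have hb_lt := lo_lt_hi b
    have hroot := C.lo_root hn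
    rw [adj_iff] at hab
    simp only [adj_iff] at noncrossing
    obtain rfl | ha := noncrossing ha <;> obtain rfl | hb := noncrossing hb <;> omega

theorem IsConnected.mem_Ioo_iff (hC : C.IsConnected) (hm : lo m = 1) {k : C.Chord}
    (hk : k ∈ C.share hn m) {p : Fin (2 * n)} (hp_pos : 0 < p.1) (hp : p ∉ points (C.share hn m)) :
    lo k < p ∧ p < hi k ↔ lo k < hi (C.root hn) ∧ hi (C.root hn) < hi k := by
  obtain ⟨c, rfl | rfl⟩ := C.exists_chord p
  · rw [val_mem_points] at hp
    rw [← hC.hi_mem_Ioo_iff hm hk hp]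
    have hcr : c ≠ C.root hn := by rintro rfl; exact hp_pos.ne' rfl
    have hadj := not_adj_of_mem_share hk hp hcr
    have hne := endpoints_ne (ne_of_mem_of_not_mem hk hp)
    have hlt := lo_lt_hi c
    rw [adj_iff] at hadj
    change lo k < lo c ∧ lo c < hi k ↔ _
    omega
  · rw [partner_mem_points, val_mem_points] at hp
    exact hC.hi_mem_Ioo_iff hm hk hp

theorem IsConnected.not_between_of_mem_points_share (hC : C.IsConnected) (hm : lo m = 1)
    {p q : Fin (2 * n)} (hp_pos : 0 < p.1) (hp : p ∉ points (C.share hn m))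
    (hq : q ∈ points (C.share hn m)) :
    ¬ (p.1 < q ∧ q < hi (C.root hn)) ∧ ¬ (hi (C.root hn) < q.1 ∧ q < p) := by
  have hsep (k : C.Chord) (hk : k ∈ C.share hn m) := hC.mem_Ioo_iff hm hk hp_pos hp
  have hne (k : C.Chord) (hk : k ∈ C.share hn m) : p.1 ≠ lo k ∧ p.1 ≠ hi k ∧
      hi (C.root hn) ≠ lo k ∧ hi (C.root hn) ≠ hi k := by
    have hk_root := endpoints_ne (ne_root_of_mem_share hk)
    exact ⟨fun e => hp (mem_points.2 ⟨k, hk, Or.inl (Fin.ext e)⟩),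
      fun e => hp (mem_points.2 ⟨k, hk, Or.inr (Fin.ext e)⟩), hk_root.2.1.symm,
      hk_root.2.2.2.symm⟩
  have hroot_pos : 0 < hi (C.root hn) := lo_lt_hi (C.root hn)
  have both_iff (y z : ℕ) (hyz : y = p ∧ z = hi (C.root hn) ∨ y = hi (C.root hn) ∧ z = p)
      (k : C.Chord) (hk : k ∈ C.share hn m) :
      y < lo k ∧ lo k < z ↔ y < hi k ∧ hi k < z := by
    have hsep := hsep k hk
    have hne := hne k hk
    have hlt := lo_lt_hi k
    omega
  obtain ⟨k, hk, hq⟩ := mem_points.1 hq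
  have hq : q.1 = lo k ∨ q.1 = hi k := hq.imp (congrArg Fin.val) (congrArg Fin.val)
  have hp_root := not_lo_mem_Ioo_of_mem_component (hm.trans_le hp_pos)
    (both_iff _ _ (Or.inl ⟨rfl, rfl⟩)) hk
  have hroot_p := not_lo_mem_Ioo_of_mem_component (hm.trans_le hroot_pos)
    (both_iff _ _ (Or.inr ⟨rfl, rfl⟩)) hk
  have hp_root_iff := both_iff _ _ (Or.inl ⟨rfl, rfl⟩) k hk
  have hroot_p_iff := both_iff _ _ (Or.inr ⟨rfl, rfl⟩) k hk
  rw [Fin.lt_def]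
  obtain hq | hq := hq <;> rw [hq] <;> omega

theorem IsConnected.exists_compl_points_share_eq_Icc (hC : C.IsConnected) (hm : lo m = 1) :
    ∃ s t : Fin (2 * n), 1 < s.1 ∧ s.1 ≤ hi (C.root hn) ∧
      (points (C.share hn m))ᶜ.erase (C.root hn).1 = Finset.Icc s t := by
  set K := points (C.share hn m)
  set Q := Kᶜ.erase (C.root hn).1 with hQ
  have mem_Q (p : Fin (2 * n)) : p ∈ Q ↔ 0 < p.1 ∧ p ∉ K := by
    rw [hQ, Finset.mem_erase, Finset.mem_compl, Nat.pos_iff_ne_zero]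
    exact and_congr_left' Fin.ext_iff.not
  have hmr : m ≠ C.root hn := fun e => by simp [e, lo_root] at hm
  have hm_mem : m.1 ∈ K := val_mem_points.2 (mem_share_self hmr)
  have hroot : C.partner (C.root hn).1 ∈ Q := (mem_Q _).2 ⟨lo_lt_hi (C.root hn), fun h =>
    ne_root_of_mem_share (val_mem_points.1 (partner_mem_points.1 h)) rfl⟩
  have hQ_ne : Q.Nonempty := ⟨_, hroot⟩
  obtain ⟨hs_pos, hs⟩ := (mem_Q _).1 (Q.min'_mem hQ_ne)
  obtain ⟨ht_pos, ht⟩ := (mem_Q _).1 (Q.max'_mem hQ_ne)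
  have hs_ne : (Q.min' hQ_ne).1 ≠ 1 := fun e =>
    hs ((Fin.ext (e.trans hm.symm) : Q.min' hQ_ne = m.1) ▸ hm_mem)
  refine ⟨Q.min' hQ_ne, Q.max' hQ_ne, by omega, Q.min'_le _ hroot, ?_⟩
  ext p
  rw [Finset.mem_Icc]
  refine ⟨fun hp => ⟨Q.min'_le _ hp, Q.le_max' _ hp⟩, fun ⟨hsp, hpt⟩ =>
    (mem_Q p).2 ⟨hs_pos.trans_le hsp, fun hp => ?_⟩⟩
  have hbelow := (hC.not_between_of_mem_points_share hm hs_pos hs hp).1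
  have habove := (hC.not_between_of_mem_points_share hm ht_pos ht hp).2
  have hps : p.1 ≠ Q.min' hQ_ne := Fin.val_ne_of_ne (ne_of_mem_of_not_mem hp hs)
  have hpt' : p.1 ≠ Q.max' hQ_ne := Fin.val_ne_of_ne (ne_of_mem_of_not_mem hp ht)
  have hpr : p.1 ≠ hi (C.root hn) :=
    Fin.val_ne_of_ne (ne_of_mem_of_not_mem hp ((mem_Q _).1 hroot).2)
  rw [Fin.le_def] at hsp hpt
  rw [Fin.lt_def] at habove
  omega

theorem IsConnected.exists_range_shareEmb_eq_points (hC : C.IsConnected) (hm : lo m = 1) :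
    ∃ (a b j : ℕ) (h : IsSlot n a b j), Set.range (shareEmb h) = points (C.share hn m) := by
  obtain ⟨s, t, hs, hs_root, hQ⟩ := hC.exists_compl_points_share_eq_Icc (hn := hn) hm
  have hmr : m ≠ C.root hn := fun e => by simp [e, lo_root] at hm
  obtain ⟨k, hk, hk_hi⟩ := hC.exists_mem_share_hi_root_lt hmr
  have hk_lt := hi_lt k
  have hroot : (C.root hn).1 ∉ points (C.share hn m) :=
    fun h => ne_root_of_mem_share (val_mem_points.1 h) rfl
  have mem_iff (p : Fin (2 * n)) : p ∈ points (C.share hn m) ↔ 0 < p.1 ∧ (p.1 < s ∨ t < p.1) := by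
    have hp : ¬ p.1 = 0 ∧ p ∉ points (C.share hn m) ↔ s ≤ p ∧ p ≤ t := by
      rw [← Finset.mem_Icc, ← hQ, Finset.mem_erase, Finset.mem_compl]
      exact and_congr_left' (Fin.ext_iff (b := (C.root hn).1)).not.symm
    have hp_zero : p.1 = 0 → p ∉ points (C.share hn m) := fun e => by
      rwa [show p = (C.root hn).1 from Fin.ext e]
    rw [Fin.le_def, Fin.le_def] at hp
    grind
  have ht_lt : t.1 < hi k := by
    have hk_mem := (mem_iff _).1 (partner_mem_points.2 (val_mem_points.2 hk))
    change 0 < hi k ∧ (hi k < s ∨ t < hi k) at hk_mem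
    omega
  have hcard : 2 * n = 2 * (C.share hn m).card + (t + 1 - s) + 1 := by
    rw [← card_points, ← Fin.card_Icc, ← hQ, add_assoc,
      Finset.card_erase_add_one (Finset.mem_compl.2 hroot), Finset.card_add_card_compl,
      Fintype.card_fin]
  refine ⟨n - (C.share hn m).card, (C.share hn m).card, s - 1,
    ⟨by omega, by omega, by omega, by omega⟩, Set.ext fun p => ?_⟩
  rw [mem_range_shareEmb, Finset.mem_coe, mem_iff]
  omega

theorem IsConnected.exists_isInsertion (hC : C.IsConnected) (hn : 2 ≤ n) :
    ∃ (a b j : ℕ) (h : IsSlot n a b j) (C₁ : RootedChordDiagram a) (C₂ : RootedChordDiagram b),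
      C₁.IsConnected ∧ C₂.IsConnected ∧ IsInsertion h C₁ C₂ C := by
  obtain ⟨m, hm⟩ := hC.exists_lo_eq_one hn
  have hroot : C.root hC.pos ∉ C.share hC.pos m := fun h => ne_root_of_mem_share h rfl
  have hm_mem : m ∈ Finset.univ.erase (C.root hC.pos) :=
    Finset.mem_erase.2 ⟨fun e => by simp [e, lo_root] at hm, Finset.mem_univ m⟩
  obtain ⟨a, b, j, h, hrange⟩ := hC.exists_range_shareEmb_eq_points (hn := hC.pos) hm
  have hrange_compl : Set.range (rootEmb h) = points (C.share hC.pos m)ᶜ := by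
    ext p
    rw [Finset.mem_coe, mem_points_compl, ← Finset.mem_coe, ← hrange,
      mem_range_shareEmb_iff_notMem, not_not]
  obtain ⟨C₁, h₁, hmap₁⟩ :=
    IsEmbedding.exists_of_range_eq_points (strictMono_rootEmb h) hrange_compl
  obtain ⟨C₂, h₂, hmap₂⟩ := IsEmbedding.exists_of_range_eq_points (strictMono_shareEmb h) hrange
  refine ⟨a, b, j, h, C₁, C₂, ?_, h₂.isConnected_of_map_univ_eq_component hm_mem hmap₂, h₁, h₂⟩
  refine h₁.isConnected_of_map_univ_eq_component (Finset.mem_compl.2 hroot) (hmap₁.trans ?_)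
  exact (hC.component_compl_component _ _).symm

theorem IsInsertion.points_share {a b j : ℕ} {h : IsSlot n a b j} {C₁ : RootedChordDiagram a}
    {C₂ : RootedChordDiagram b} (hC : IsInsertion h C₁ C₂ C) (h₂ : C₂.IsConnected) (hm : lo m = 1) :
    (points (C.share h.pos m) : Set (Fin (2 * n))) = Set.range (shareEmb h) := by
  obtain rfl : hC.right.chordMap (C₂.root h.pos_right) = m :=
    lo_injective (hC.lo_chordMap_right_root.trans hm.symm)
  rw [share, hC.component_erase_root h₂, hC.right.points_map_univ]

theorem IsInsertion.slot_unique {a b j a' b' j' : ℕ} {h : IsSlot n a b j} {h' : IsSlot n a' b' j'}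
    {C₁ : RootedChordDiagram a} {C₂ : RootedChordDiagram b} {C₁' : RootedChordDiagram a'}
    {C₂' : RootedChordDiagram b'} (hC : IsInsertion h C₁ C₂ C) (hC' : IsInsertion h' C₁' C₂' C)
    (h₂ : C₂.IsConnected) (h₂' : C₂'.IsConnected) : a = a' ∧ b = b' ∧ j = j' := by
  have hrange : Set.range (shareEmb h) = Set.range (shareEmb h') :=
    (hC.points_share h₂ hC.lo_chordMap_right_root).symm.trans
      (hC'.points_share h₂' hC.lo_chordMap_right_root)
  have hmem (p : ℕ) (hp : p < 2 * n) :
      0 < p ∧ p ≤ j ∨ j + 2 * a ≤ p ↔ 0 < p ∧ p ≤ j' ∨ j' + 2 * a' ≤ p := by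
    simpa only [mem_range_shareEmb] using Set.ext_iff.1 hrange ⟨p, hp⟩
  obtain ⟨ha, -, hjb, hab⟩ := id h
  obtain ⟨ha', -, hjb', hab'⟩ := id h'
  have hj := hmem (j + 1) (by omega)
  have hj' := hmem (j' + 1) (by omega)
  have hja := hmem (j + 2 * a) (by omega)
  have hja' := hmem (j' + 2 * a') (by omega)
  omega

end Share

/-! ### Statistics of connected diagrams -/

section Statistics

variable {n : ℕ} {C : RootedChordDiagram n}

theorem word_of_one (C : RootedChordDiagram 1) : C.word = [true] := by
  have : Subsingleton C.Chord := Fintype.card_le_one_iff_subsingleton.1 C.card_chord.le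
  have isTerminal (c : C.Chord) : C.IsTerminal c := fun d h =>
    lt_irrefl _ (Subsingleton.elim d c ▸ h).1
  refine List.eq_replicate_iff.2 ⟨C.length_word, fun x hx => ?_⟩
  obtain ⟨c, -, rfl⟩ := List.mem_map.1 hx
  exact decide_eq_true (isTerminal c)

theorem IsConnected.suffix_word (hC : C.IsConnected) : [true] <:+ C.word := by
  induction n using Nat.strong_induction_on with
  | _ n ih =>
    rcases Nat.lt_or_ge n 2 with hn | hn
    · obtain rfl : n = 1 := by have := hC.pos; omega
      rw [C.word_of_one]
    · obtain ⟨a, b, j, h, C₁, C₂, h₁, h₂, hI⟩ := hC.exists_isInsertion hn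
      have ha := h.pos_left
      have hb := h.pos_right
      have hab := h.add_eq
      rw [hI.word_eq h₁ h₂]
      refine List.IsSuffix.trans ?_ (List.suffix_cons _ _)
      obtain ⟨u, hu⟩ := ih a (by omega) h₁
      rw [← hu]
      cases u with
      | nil => simpa using ih b (by omega) h₂
      | cons x u => exact ⟨C₂.word ++ u, by simp⟩

theorem IsConnected.true_mem_word (hC : C.IsConnected) : true ∈ C.word :=
  hC.suffix_word.subset (List.mem_singleton_self true)

theorem IsConnected.one_le_b (hC : C.IsConnected) : 1 ≤ C.b := by
  rw [C.b_eq_idxOf hC.true_mem_word]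
  exact Nat.le_add_left _ _

theorem IsConnected.b_le (hC : C.IsConnected) : C.b ≤ n := by
  rw [C.b_eq_idxOf hC.true_mem_word]
  exact (List.idxOf_lt_length_of_mem hC.true_mem_word).trans_eq C.length_word

variable {a b j : ℕ} {h : IsSlot n a b j} {C₁ : RootedChordDiagram a} {C₂ : RootedChordDiagram b}

theorem IsInsertion.b_eq (hC : IsInsertion h C₁ C₂ C) (h₁ : C₁.IsConnected)
    (h₂ : C₂.IsConnected) : C.b = C₂.b + 1 := by
  rw [C.b_eq_idxOf (hC.isConnected h₁ h₂).true_mem_word, C₂.b_eq_idxOf h₂.true_mem_word,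
    hC.word_eq h₁ h₂, List.idxOf_cons_ne _ (by decide), List.idxOf_append_of_mem h₂.true_mem_word]

theorem IsInsertion.monomial_eq {R : Type*} [CommRing R] (f : ℕ → R)
    (hC : IsInsertion h C₁ C₂ C) (h₁ : C₁.IsConnected) (h₂ : C₂.IsConnected) :
    C.monomial f = f (C₁.b - 1) * C₁.monomial f * C₂.monomial f := by
  have h₁_mem := h₁.true_mem_word
  rw [C.monomial_eq_weight f (hC.isConnected h₁ h₂).true_mem_word,
    C₁.monomial_eq_weight f h₁_mem, C₂.monomial_eq_weight f h₂.true_mem_word,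
    C₁.b_eq_idxOf h₁_mem, hC.word_eq h₁ h₂, TerminalWord.weight,
    TerminalWord.weight_append f h₂.suffix_word, Nat.add_sub_cancel]
  obtain ⟨x, t, hw⟩ := List.exists_cons_of_ne_nil (List.ne_nil_of_mem h₁_mem)
  rw [hw] at h₁_mem ⊢
  rw [← TerminalWord.mul_weightFrom_tail f h₁_mem, List.tail_cons]
  ring

end Statistics

/-! ### Sums over connected diagrams -/

section Sums

open Finset.HasAntidiagonal

/-- The connected diagrams with `n` chords. -/
abbrev Connected (n : ℕ) : Type := {C : RootedChordDiagram n // C.IsConnected}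

/-- The data of an insertion that gives a connected diagram with `n` chords: the sizes, the inserted
diagram, the diagram that receives it, and the slot, numbered from `0`. -/
abbrev InsertionData (n : ℕ) : Type :=
  Σ q : antidiagonal n, Connected q.1.1 × Connected q.1.2 × Fin (2 * q.1.2 - 1)

theorem InsertionData.isSlot {n : ℕ} (d : InsertionData n) :
    IsSlot n d.1.1.1 d.1.1.2 (d.2.2.2.1 + 1) where
  pos_left := d.2.1.2.pos
  pos_slot := Nat.succ_pos _
  slot_lt := by have := d.2.2.2.2; omega
  add_eq := mem_antidiagonal.1 d.1.2

/-- The connected diagram given by the data of an insertion. -/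
def InsertionData.glue {n : ℕ} (d : InsertionData n) : Connected n :=
  ⟨insertion d.isSlot d.2.1.1 d.2.2.1.1,
    (isInsertion_insertion d.isSlot _ _).isConnected d.2.1.2 d.2.2.1.2⟩

theorem InsertionData.isInsertion {n : ℕ} (d : InsertionData n) :
    IsInsertion d.isSlot d.2.1.1 d.2.2.1.1 d.glue.1 :=
  isInsertion_insertion d.isSlot _ _

theorem InsertionData.glue_injective {n : ℕ} : Function.Injective (glue (n := n)) := by
  intro d d' e
  have hI := d.isInsertion
  have hI' := d'.isInsertion
  rw [← e] at hI'
  obtain ⟨ha, hb, hj⟩ := hI.slot_unique hI' d.2.2.1.2 d'.2.2.1.2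
  obtain ⟨⟨⟨a, b⟩, _⟩, ⟨C₁, _⟩, ⟨C₂, _⟩, ⟨j, _⟩⟩ := d
  obtain ⟨⟨⟨a', b'⟩, _⟩, ⟨C₁', _⟩, ⟨C₂', _⟩, ⟨j', _⟩⟩ := d'
  dsimp only at ha hb hj
  obtain rfl : j = j' := by omega
  subst ha hb
  obtain rfl : C₁ = C₁' := hI.left.unique hI'.left
  obtain rfl : C₂ = C₂' := hI.right.unique hI'.right
  rfl

theorem InsertionData.glue_bijective {n : ℕ} (hn : 2 ≤ n) : Function.Bijective (glue (n := n)) := by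
  refine ⟨glue_injective, fun ⟨C, hC⟩ => ?_⟩
  obtain ⟨a, b, j, h, C₁, C₂, h₁, h₂, hI⟩ := hC.exists_isInsertion hn
  have hjb := h.slot_lt
  obtain ⟨j, rfl⟩ := Nat.exists_eq_succ_of_ne_zero h.pos_slot.ne'
  let d : InsertionData n :=
    ⟨⟨(a, b), mem_antidiagonal.2 h.add_eq⟩, ⟨C₁, h₁⟩, ⟨C₂, h₂⟩, ⟨j, by dsimp only; omega⟩⟩
  exact ⟨d, Subtype.ext (d.isInsertion.unique hI)⟩

instance instUniqueConnectedOne : Unique (Connected 1) where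
  default := by
    let C : RootedChordDiagram 1 := ⟨Fin.rev, Fin.rev_rev, by decide⟩
    have : Subsingleton C.Chord := Fintype.card_le_one_iff_subsingleton.1 C.card_chord.le
    have : Nonempty C.Chord := ⟨C.root one_pos⟩
    exact ⟨C, SimpleGraph.Connected.of_subsingleton⟩
  uniq C := by
    refine Subtype.ext (RootedChordDiagram.ext (funext fun p => Fin.ext ?_))
    have hne := Fin.val_ne_of_ne (C.1.partner_ne p)
    change _ = (Fin.rev p).1
    rw [Fin.val_rev]
    omega

variable {R : Type*} [CommRing R] (f g : ℕ → R)

/-- The sum of `g (b C) * f_C` over the connected diagrams `C` with `n` chords. -/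
def connectedSum (n : ℕ) : R := ∑ C : Connected n, g C.1.b * C.1.monomial f

theorem connectedSum_zero : connectedSum f g 0 = 0 := by
  have : IsEmpty (Connected 0) := ⟨fun C => lt_irrefl 0 C.2.pos⟩
  rw [connectedSum, Fintype.sum_empty]

theorem connectedSum_one : connectedSum f g 1 = g 1 := by
  have h := (default : Connected 1).2.true_mem_word
  rw [connectedSum, Fintype.sum_unique, b_eq_idxOf h, monomial_eq_weight _ h, word_of_one]
  simp [TerminalWord.weight, TerminalWord.weightFrom]

theorem connectedSum_eq_sum_ite (n : ℕ) : connectedSum f g n =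
    ∑ C : RootedChordDiagram n, if C.IsConnected then g C.b * C.monomial f else 0 := by
  rw [connectedSum, ← Finset.sum_filter]
  exact (Finset.sum_subtype (p := IsConnected) _ (by simp) fun C => g C.b * C.monomial f).symm

theorem connectedSum_of_two_le {n : ℕ} (hn : 2 ≤ n) :
    connectedSum f g n =
      ∑ q ∈ antidiagonal n, connectedSum f (fun b => f (b - 1)) q.1 *
        ((2 * q.2 - 1 : R) * connectedSum f (fun b => g (b + 1)) q.2) := by
  have glue_term (d : InsertionData n) : g d.glue.1.b * d.glue.1.monomial f =
      f (d.2.1.1.b - 1) * d.2.1.1.monomial f *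
        (g (d.2.2.1.1.b + 1) * d.2.2.1.1.monomial f) := by
    rw [d.isInsertion.b_eq d.2.1.2 d.2.2.1.2, d.isInsertion.monomial_eq f d.2.1.2 d.2.2.1.2]
    ring
  rw [connectedSum, ← (InsertionData.glue_bijective hn).sum_comp, Fintype.sum_sigma,
    ← Finset.sum_coe_sort (antidiagonal n)]
  refine Finset.sum_congr rfl fun q _ => ?_
  simp only [glue_term, Fintype.sum_prod_type, Finset.sum_const, Finset.card_univ,
    Fintype.card_fin, nsmul_eq_mul]
  rw [connectedSum, Finset.sum_mul]
  refine Finset.sum_congr rfl fun C₁ _ => ?_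
  rw [connectedSum, Finset.mul_sum, Finset.mul_sum]
  refine Finset.sum_congr rfl fun C₂ _ => ?_
  rw [Nat.cast_sub (by have := C₂.2.pos; omega)]
  push_cast
  ring

end Sums

end RootedChordDiagram

namespace DysonSchwinger

open PowerSeries RootedChordDiagram

/-! ### The recursion for the generating series of connected diagrams -/

section Recursion

variable (R : Type*) [CommRing R]

/-- The operator `2 x d/dx` on power series in `x`. -/
def twiceEuler : Derivation R R⟦X⟧ R⟦X⟧ := (2 * X : R⟦X⟧) • d⁄dX R

variable {R}

theorem coeff_twiceEuler (n : ℕ) (φ : R⟦X⟧) :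
    coeff n (twiceEuler R φ) = 2 * n * coeff n φ := by
  rw [twiceEuler, Derivation.smul_apply, smul_eq_mul, mul_assoc, ← map_ofNat C 2, coeff_C_mul]
  cases n with
  | zero => simp
  | succ n =>
    rw [coeff_succ_X_mul, coeff_derivative]
    push_cast
    ring

theorem twiceEuler_C_mul (r : R) (φ : R⟦X⟧) : twiceEuler R (C r * φ) = C r * twiceEuler R φ := by
  rw [← smul_eq_C_mul, Derivation.map_smul, smul_eq_C_mul]

theorem twiceEuler_X_mul (φ : R⟦X⟧) :
    twiceEuler R (X * φ) = X * (twiceEuler R φ + 2 * φ) := by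
  have twiceEuler_X : twiceEuler R X = 2 * X := by simp [twiceEuler]
  rw [Derivation.leibniz, twiceEuler_X, smul_eq_mul, smul_eq_mul]
  ring

variable (f : ℕ → R)

/-- The series `∑ g (b C) f_C x ^ |C|` over the connected diagrams `C`. -/
def connectedSeries (g : ℕ → R) : R⟦X⟧ := mk (connectedSum f g)

/-- The series `∑ f (b C - 1) f_C x ^ |C|` over the connected diagrams `C`, that is, `-γ₁`. -/
def rootSeries : R⟦X⟧ := connectedSeries f fun b => f (b - 1)

theorem connectedSeries_eq (g : ℕ → R) :
    connectedSeries f g = C (g 1) * X + rootSeries f *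
      (twiceEuler R (connectedSeries f fun b => g (b + 1)) -
        connectedSeries f fun b => g (b + 1)) := by
  ext n
  rw [map_add, coeff_C_mul, coeff_X, coeff_mul]
  simp only [map_sub, coeff_twiceEuler, rootSeries, connectedSeries, coeff_mk]
  rcases Nat.lt_or_ge n 2 with hn | hn
  · interval_cases n
    · simp [connectedSum_zero]
    · simp [Finset.Nat.antidiagonal_succ, connectedSum_zero, connectedSum_one]
  · rw [connectedSum_of_two_le f g hn, if_neg (by omega), mul_zero, zero_add]
    exact Finset.sum_congr rfl fun q _ => by ring

theorem connectedSeries_congr {g g' : ℕ → R} (h : ∀ b, 1 ≤ b → g b = g' b) :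
    connectedSeries f g = connectedSeries f g' := by
  ext n
  simp only [connectedSeries, coeff_mk, connectedSum]
  exact Finset.sum_congr rfl fun C _ => by rw [h _ C.2.one_le_b]

/-- The series `∑ f (b C - i) f_C x ^ |C|` over the connected diagrams `C` with `i ≤ b C`, which is
`γ_i` without its numerical factor. -/
def gammaSeries (i : ℕ) : R⟦X⟧ := connectedSeries f fun b => if i ≤ b then f (b - i) else 0

theorem gammaSeries_one : gammaSeries f 1 = rootSeries f :=
  connectedSeries_congr f fun _ hb => if_pos hb

theorem gammaSeries_succ {i : ℕ} (hi : 1 ≤ i) : gammaSeries f (i + 1) =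
    rootSeries f * (twiceEuler R (gammaSeries f i) - gammaSeries f i) := by
  rw [gammaSeries, connectedSeries_eq, if_neg (by omega), map_zero, zero_mul, zero_add]
  simp only [Nat.add_le_add_iff_right, Nat.add_sub_add_right]
  rfl

/-- The series `∑ f_C x ^ (|C| - 1)` over the connected diagrams `C` with `b C = b`. -/
def firstSeries (b : ℕ) : R⟦X⟧ :=
  mk fun n => connectedSum f (fun b' => if b' = b then 1 else 0) (n + 1)

theorem X_mul_firstSeries (b : ℕ) :
    X * firstSeries f b = connectedSeries f fun b' => if b' = b then 1 else 0 := by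
  ext n
  cases n with
  | zero => rw [coeff_zero_X_mul, connectedSeries, coeff_mk, connectedSum_zero]
  | succ n => rw [coeff_succ_X_mul, firstSeries, coeff_mk, connectedSeries, coeff_mk]

theorem firstSeries_one : firstSeries f 1 = 1 := by
  have shifted_eq_zero : (connectedSeries f fun b => if b + 1 = 1 then 1 else 0) = 0 := by
    rw [connectedSeries_congr f (g' := fun _ => 0) fun b hb => if_neg (by omega)]
    ext n
    simp [connectedSeries, connectedSum]
  refine X_mul_cancel ?_
  rw [X_mul_firstSeries, connectedSeries_eq, shifted_eq_zero]
  simp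

theorem firstSeries_succ {b : ℕ} (hb : 1 ≤ b) : firstSeries f (b + 1) =
    rootSeries f * (twiceEuler R (firstSeries f b) + firstSeries f b) := by
  refine X_mul_cancel ?_
  rw [X_mul_firstSeries, connectedSeries_eq, if_neg (by omega), map_zero, zero_mul, zero_add]
  simp only [Nat.add_right_cancel_iff]
  rw [← X_mul_firstSeries, twiceEuler_X_mul]
  ring

theorem X_pow_dvd_firstSeries (k : ℕ) : X ^ k ∣ firstSeries f (k + 1) := by
  refine X_pow_dvd_iff.2 fun n hn => ?_
  rw [firstSeries, coeff_mk, connectedSum]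
  refine Finset.sum_eq_zero fun C _ => ?_
  have := C.2.b_le
  rw [if_neg (by omega), zero_mul]

theorem sum_coeff_firstSeries (g : ℕ → R) (n : ℕ) :
    ∑ k ∈ Finset.range (n + 1), coeff n (firstSeries f (k + 1)) * g (k + 1) =
      connectedSum f g (n + 1) := by
  simp only [firstSeries, coeff_mk, connectedSum, Finset.sum_mul]
  rw [Finset.sum_comm]
  refine Finset.sum_congr rfl fun C _ => ?_
  have hb := C.2.one_le_b
  have hb' := C.2.b_le
  rw [Finset.sum_eq_single_of_mem (C.1.b - 1) (Finset.mem_range.2 (by omega))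
    fun k _ hk => by rw [if_neg (by omega), zero_mul, zero_mul], Nat.sub_add_cancel hb, if_pos rfl,
    one_mul, mul_comm]

end Recursion

/-! ### The inverse of the Green function -/

section Transport

variable {S A : Type*} [CommRing S] [CommRing A] [Algebra S A] (θ : Derivation S A A) {P : A}

theorem coeff_derivative_mul {U V : A⟦X⟧}
    (hU : ∀ k, coeff k (d⁄dX A U) = P * (θ (coeff k U) - coeff k U))
    (hV : ∀ k, coeff k (d⁄dX A V) = P * (θ (coeff k V) + coeff k V)) (k : ℕ) :
    coeff k (d⁄dX A (U * V)) = P * θ (coeff k (U * V)) := by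
  rw [Derivation.leibniz, smul_eq_mul, smul_eq_mul, mul_comm V, map_add, coeff_mul, coeff_mul,
    coeff_mul, map_sum, Finset.mul_sum, ← Finset.sum_add_distrib]
  refine Finset.sum_congr rfl fun q _ => ?_
  rw [hU, hV, Derivation.leibniz, smul_eq_mul, smul_eq_mul]
  ring

theorem eq_one_of_coeff_derivative [IsAddTorsionFree A] {W : A⟦X⟧} (h₀ : coeff 0 W = 1)
    (hW : ∀ k, coeff k (d⁄dX A W) = P * θ (coeff k W)) : W = 1 := by
  ext k
  induction k with
  | zero => rw [h₀, coeff_zero_one]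
  | succ k ih =>
    have coeff_eq_zero : (k + 1) • coeff (k + 1) W = 0 := by
      rw [nsmul_eq_mul, mul_comm, Nat.cast_succ, ← coeff_derivative, hW, ih, coeff_one]
      split_ifs <;> simp
    rw [(nsmul_eq_zero_iff_right k.succ_ne_zero).1 coeff_eq_zero, coeff_one,
      if_neg k.succ_ne_zero]

end Transport

section Inverse

theorem coeff_greenSeries_zero {R : Type*} [CommRing R] (γ : ℕ → R⟦X⟧) :
    coeff 0 (greenSeries γ) = 1 := by
  simp [greenSeries]

theorem coeff_greenSeries {R : Type*} [CommRing R] {k : ℕ} (hk : 1 ≤ k) (γ : ℕ → R⟦X⟧) :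
    coeff k (greenSeries γ) = -γ k := by
  rw [greenSeries, map_sub, coeff_one, if_neg (by omega), coeff_mk, if_pos hk, zero_sub]

variable (R : Type*) [CommRing R] [Algebra ℚ R]

/-- The coefficient `(-1)^i / i!` of `e^{-x}`. -/
def expNegCoeff (i : ℕ) : R := algebraMap ℚ R ((-1) ^ i / (i.factorial : ℚ))

theorem expNegCoeff_zero : expNegCoeff R 0 = 1 := by simp [expNegCoeff]

theorem neg_one_pow_mul_factorial_mul_expNegCoeff (i : ℕ) :
    (-1 : R) ^ i * (i.factorial : R) * expNegCoeff R i = 1 := by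
  have factorial_ne_zero : (i.factorial : ℚ) ≠ 0 := by positivity
  have rat_eq : (-1 : ℚ) ^ i * i.factorial * ((-1) ^ i / i.factorial) = 1 := by
    rw [mul_assoc, mul_div_cancel₀ _ factorial_ne_zero, ← mul_pow]
    simp
  simpa [expNegCoeff] using congrArg (algebraMap ℚ R) rat_eq

theorem expNegCoeff_succ_mul (i : ℕ) :
    expNegCoeff R (i + 1) * (i + 1 : R) = -expNegCoeff R i := by
  have rat_eq : (-1 : ℚ) ^ (i + 1) / (i + 1).factorial * (i + 1) = -((-1) ^ i / i.factorial) := by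
    rw [Nat.factorial_succ]
    push_cast
    field_simp
    ring
  simpa [expNegCoeff] using congrArg (algebraMap ℚ R) rat_eq

theorem C_expNegCoeff_succ_mul (k : ℕ) :
    C (expNegCoeff R (k + 1)) * (k + 1 : R⟦X⟧) = -C (expNegCoeff R k) := by
  simpa using congrArg C (expNegCoeff_succ_mul R k)

variable {R} (f : ℕ → R)

theorem gamma_eq (i : ℕ) : gamma f i = C (expNegCoeff R i) * gammaSeries f i := by
  ext n
  rw [coeff_C_mul, gamma, coeff_mk, gammaSeries, connectedSeries, coeff_mk,
    connectedSum_eq_sum_ite, expNegCoeff]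
  congr 1
  refine Finset.sum_congr rfl fun C _ => ?_
  by_cases hC : C.IsConnected <;> by_cases hi : i ≤ C.b <;> simp [hC, hi, mul_comm]

/-- The series `∑_k h_k D^k` with `h_k = ((-1)^k / k!) ∑_{b(C) = k + 1} f_C x^{|C| - 1}`, which is
the inverse of `G(x, D)`. -/
def greenInverse : R⟦X⟧⟦X⟧ := mk fun k => C (expNegCoeff R k) * firstSeries f (k + 1)

theorem coeff_derivative_greenSeries (k : ℕ) :
    coeff k (d⁄dX R⟦X⟧ (greenSeries (gamma f))) = -rootSeries f *
      (twiceEuler R (coeff k (greenSeries (gamma f))) - coeff k (greenSeries (gamma f))) := by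
  have coeff_eq : coeff k (d⁄dX R⟦X⟧ (greenSeries (gamma f))) =
      C (expNegCoeff R k) * gammaSeries f (k + 1) := by
    rw [coeff_derivative, coeff_greenSeries (by omega), gamma_eq]
    linear_combination (-gammaSeries f (k + 1)) * C_expNegCoeff_succ_mul R k
  rw [coeff_eq]
  rcases Nat.eq_zero_or_pos k with rfl | hk
  · rw [coeff_greenSeries_zero, expNegCoeff_zero, gammaSeries_one, Derivation.map_one_eq_zero]
    simp
  · rw [coeff_greenSeries hk, gamma_eq, gammaSeries_succ f hk, Derivation.map_neg,
      twiceEuler_C_mul]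
    ring

theorem coeff_derivative_greenInverse (k : ℕ) :
    coeff k (d⁄dX R⟦X⟧ (greenInverse f)) = -rootSeries f *
      (twiceEuler R (coeff k (greenInverse f)) + coeff k (greenInverse f)) := by
  rw [coeff_derivative, greenInverse, coeff_mk, coeff_mk, firstSeries_succ f (by omega),
    twiceEuler_C_mul]
  linear_combination (rootSeries f * (twiceEuler R (firstSeries f (k + 1)) +
    firstSeries f (k + 1))) * C_expNegCoeff_succ_mul R k

theorem greenSeries_mul_greenInverse : greenSeries (gamma f) * greenInverse f = 1 := by
  have : IsAddTorsionFree R⟦X⟧ := IsAddTorsionFree.of_module_rat R⟦X⟧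
  refine eq_one_of_coeff_derivative (twiceEuler R) ?_ (coeff_derivative_mul (twiceEuler R)
    (coeff_derivative_greenSeries f) (coeff_derivative_greenInverse f))
  rw [coeff_mul, Finset.Nat.antidiagonal_zero, Finset.sum_singleton, coeff_greenSeries_zero,
    greenInverse, coeff_mk, expNegCoeff_zero, firstSeries_one, map_one, one_mul, one_mul]

theorem X_pow_dvd_coeff_greenInverse (k : ℕ) : X ^ k ∣ coeff k (greenInverse f) := by
  rw [greenInverse, coeff_mk]
  exact (X_pow_dvd_firstSeries f k).mul_left _

end Inverse

/-! ### Evaluation of the operator series -/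

section Operator

/-- The sum of `H(x, ∂_{-ρ}) Φ` when the `k`-th coefficient of `H` is divisible by `x ^ k`, so that
the first `n + 1` terms determine the coefficient of `x ^ n`. -/
def operatorValue {R : Type*} [CommRing R] (H : R⟦X⟧⟦X⟧) (Φ : R⟦X⟧⟦X⟧⟦X⟧) : R⟦X⟧⟦X⟧⟦X⟧ :=
  mk fun r => mk fun m => mk fun n =>
    ∑ k ∈ Finset.range (n + 1), coeff n (coeff k H * coeff m (coeff r (negDeriv^[k] Φ)))

theorem isOperatorValue_operatorValue {R : Type*} [CommRing R] {H : R⟦X⟧⟦X⟧}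
    (hH : ∀ k, X ^ k ∣ coeff k H) (Φ : R⟦X⟧⟦X⟧⟦X⟧) :
    IsOperatorValue H Φ (operatorValue H Φ) := by
  intro r m n
  filter_upwards [Filter.eventually_ge_atTop (n + 1)] with N hN
  simp only [operatorValue, map_sum, coeff_C_mul, coeff_mk]
  refine (Finset.sum_subset (Finset.range_subset_range.2 hN) fun k _ hk => ?_).symm
  rw [Finset.mem_range, not_lt] at hk
  exact X_pow_dvd_iff.1 ((hH k).mul_right _) n hk

theorem constantCoeff_negDeriv_iterate {A : Type*} [CommRing A] (Φ : A⟦X⟧) (k : ℕ) :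
    constantCoeff (negDeriv^[k] Φ) = (-1) ^ k * (k.factorial : A) * coeff k Φ := by
  have iterate_eq : negDeriv^[k] Φ = (-1 : A) ^ k • (d⁄dX A)^[k] Φ := by
    induction k with
    | zero => simp
    | succ k ih =>
      rw [Function.iterate_succ_apply', Function.iterate_succ_apply', ih, negDeriv,
        Derivation.map_smul, pow_succ, mul_neg_one, neg_smul]
  rw [iterate_eq, constantCoeff_smul, constantCoeff_iterate_derivative, smul_eq_mul, mul_assoc]

end Operator

section Equation

variable {R : Type*} [CommRing R] [Algebra ℚ R] (f : ℕ → R)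

theorem coeff_expNegLRho (i : ℕ) :
    coeff i (expNegLRho R) = C (C (expNegCoeff R i)) * (X : R⟦X⟧⟦X⟧) ^ i := by
  have algebraMap_eq (q : ℚ) : algebraMap ℚ R⟦X⟧⟦X⟧ q = C (C (algebraMap ℚ R q)) :=
    RingHom.congr_fun (Subsingleton.elim (algebraMap ℚ R⟦X⟧⟦X⟧)
      (C.comp (C.comp (algebraMap ℚ R)))) q
  have expNegCoeff_eq : expNegCoeff R i = (-1) ^ i * algebraMap ℚ R (1 / i.factorial) := by
    simp [expNegCoeff, div_eq_mul_inv]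
  rw [expNegLRho, coeff_rescale, coeff_exp, algebraMap_eq, expNegCoeff_eq, neg_pow]
  simp only [map_mul, map_pow, map_neg, map_one]
  ring

/-- The power series `(e^{-Lρ} - 1) F(ρ)`: the pole of `F` is moved to the first factor, which
becomes `(e^{-Lρ} - 1) / ρ`. -/
def kernelSeries : R⟦X⟧⟦X⟧⟦X⟧ :=
  (mk fun i => coeff (i + 1) (expNegLRho R)) * mk fun k => C (C (f k))

theorem ofPowerSeries_kernelSeries :
    HahnSeries.ofPowerSeries ℤ R⟦X⟧⟦X⟧ (kernelSeries f) =
      HahnSeries.ofPowerSeries ℤ R⟦X⟧⟦X⟧ (expNegLRho R - 1) * laurentF f := by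
  have expNegLRho_sub_one :
      expNegLRho R - 1 = X * mk fun i => coeff (i + 1) (expNegLRho R) := by
    rw [← sub_const_eq_X_mul_shift, ← coeff_zero_eq_constantCoeff_apply, coeff_expNegLRho]
    simp [expNegCoeff_zero]
  rw [laurentF, mul_left_comm, ← map_mul, expNegLRho_sub_one, mul_assoc, ← kernelSeries, map_mul,
    HahnSeries.ofPowerSeries_X, ← mul_assoc, HahnSeries.single_mul_single]
  simp

theorem coeff_kernelSeries (k : ℕ) : coeff k (kernelSeries f) =
    ∑ i ∈ Finset.range (k + 1), C (C (expNegCoeff R (i + 1) * f (k - i))) * X ^ (i + 1) := by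
  rw [kernelSeries, coeff_mul, Finset.Nat.sum_antidiagonal_eq_sum_range_succ_mk]
  refine Finset.sum_congr rfl fun i _ => ?_
  rw [coeff_mk, coeff_mk, coeff_expNegLRho, map_mul, map_mul]
  ring

theorem coeff_zero_coeff_kernelSeries (k : ℕ) : coeff 0 (coeff k (kernelSeries f)) = 0 := by
  rw [coeff_kernelSeries, map_sum]
  exact Finset.sum_eq_zero fun i _ => by simp

theorem coeff_succ_coeff_kernelSeries (k m : ℕ) : coeff (m + 1) (coeff k (kernelSeries f)) =
    C (expNegCoeff R (m + 1) * if m ≤ k then f (k - m) else 0) := by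
  simp only [coeff_kernelSeries, map_sum, coeff_C_mul, coeff_X_pow, Nat.add_right_cancel_iff,
    mul_ite, mul_one, mul_zero, Finset.sum_ite_eq, Finset.mem_range, Nat.lt_succ_iff]
  split_ifs <;> simp

theorem coeff_greenInverse_mul (Φ : R⟦X⟧⟦X⟧⟦X⟧) (k m : ℕ) :
    coeff k (greenInverse f) * coeff m (constantCoeff (negDeriv^[k] Φ)) =
      firstSeries f (k + 1) * coeff m (coeff k Φ) := by
  have factorial_cancel : C ((-1) ^ k * (k.factorial : R)) * C (expNegCoeff R k) = 1 := by
    rw [← map_mul, neg_one_pow_mul_factorial_mul_expNegCoeff, map_one]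
  have scalar_eq : ((-1 : R⟦X⟧⟦X⟧)) ^ k * (k.factorial : R⟦X⟧⟦X⟧) =
      C (C ((-1) ^ k * (k.factorial : R))) := by simp
  rw [constantCoeff_negDeriv_iterate, scalar_eq, coeff_C_mul, greenInverse, coeff_mk]
  linear_combination (firstSeries f (k + 1) * coeff m (coeff k Φ)) * factorial_cancel

theorem coeff_constantCoeff_operatorValue_greenInverse (Φ : R⟦X⟧⟦X⟧⟦X⟧) (m n : ℕ) :
    coeff n (coeff m (constantCoeff (operatorValue (greenInverse f) Φ))) =
      ∑ k ∈ Finset.range (n + 1), coeff n (firstSeries f (k + 1) * coeff m (coeff k Φ)) := by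
  simp only [operatorValue, ← coeff_zero_eq_constantCoeff_apply, coeff_mk]
  simp only [coeff_zero_eq_constantCoeff_apply, coeff_greenInverse_mul]

theorem X_mul_coeff_succ_operatorValue (m : ℕ) :
    X * coeff (m + 1) (constantCoeff (operatorValue (greenInverse f) (kernelSeries f))) =
      gamma f (m + 1) := by
  rw [gamma_eq, gammaSeries, connectedSeries]
  ext n
  cases n with
  | zero => rw [coeff_zero_X_mul, coeff_C_mul, coeff_mk, connectedSum_zero, mul_zero]
  | succ n =>
    rw [coeff_succ_X_mul, coeff_constantCoeff_operatorValue_greenInverse, coeff_C_mul, coeff_mk,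
      ← sum_coeff_firstSeries, Finset.mul_sum]
    refine Finset.sum_congr rfl fun k _ => ?_
    rw [coeff_succ_coeff_kernelSeries, coeff_mul_C]
    simp only [Nat.add_le_add_iff_right, Nat.add_sub_add_right]
    ring

theorem greenSeries_gamma_eq : greenSeries (gamma f) = 1 - C (X : R⟦X⟧) *
    constantCoeff (operatorValue (greenInverse f) (kernelSeries f)) := by
  ext1 m
  rw [map_sub, coeff_C_mul]
  cases m with
  | zero =>
    have coeff_value_eq_zero :
        coeff 0 (constantCoeff (operatorValue (greenInverse f) (kernelSeries f))) = 0 := by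
      ext n
      simp only [coeff_constantCoeff_operatorValue_greenInverse, coeff_zero_coeff_kernelSeries,
        mul_zero, map_zero, Finset.sum_const_zero]
    rw [coeff_greenSeries_zero, coeff_zero_one, coeff_value_eq_zero, mul_zero, sub_zero]
  | succ m =>
    rw [coeff_greenSeries (by omega), X_mul_coeff_succ_operatorValue, coeff_one, if_neg (by omega),
      zero_sub]

end Equation

end DysonSchwinger

end

theorem mainTheorem1 {R : Type*} [CommRing R] [Algebra ℚ R] (f : ℕ → R) :
    DysonSchwinger.IsSolution f
      (DysonSchwinger.greenSeries (DysonSchwinger.gamma f)) := by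
  open DysonSchwinger in
  exact ⟨greenInverse f, kernelSeries f, operatorValue (greenInverse f) (kernelSeries f),
    greenSeries_mul_greenInverse f, ofPowerSeries_kernelSeries f,
    isOperatorValue_operatorValue (X_pow_dvd_coeff_greenInverse f) _, greenSeries_gamma_eq f⟩
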